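/- Let $d\ge 2$ and let $Y=(-\tfrac12,\tfrac12)^d$ be the unit cell. **Notions.** $C^{k,\alpha}(\bar Y)$ denotes the space of $k$ times continuously differentiable functions on $\bar Y$ with $\alpha$-Hölder (for $\alpha=1$: Lipschitz) $k$-th derivatives, with its usual norm. For a neighbourhood $U$ of $\partial Y$, $\mathrm{Diff}^{k,\alpha}_\Box(\bar Y)$ is the set of bijections $g:\bar Y\to\bar Y$ such that $g$ and $g^{-1}$ are of class $C^{k,\alpha}(\bar Y)$ and $g=\mathrm{id}$ on $U\cap\bar Y$. A function $\Phi_0\in C^{k,\alpha}(Y)$ is a *regular level-set function* associated to $\Gamma$ if $\Gamma$ is the boundary of an open set $O$ of class $C^{k,\alpha}$ compactly contained in $Y$, $\Gamma=\{y\in Y:\Phi_0(y)=0\}$, and $\nabla\Phi_0=-\nu$ on $\Gamma$, where $\nu$ is the outer unit normal of $O$. For a velocity $w:\bar Y\to\mathbb R$ a *solution on $[0,T]\times D$ of the level-set equation with velocity $w$* is a function $\Phi\in C^2([0,T]\times D)$ with $$\partial_t\Phi+w\,|\nabla_y\Phi|=0\ \text{ in }(0,T)\times \operatorname{int}D,\qquad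 \Phi(0,\cdot)=\Phi_0\ \text{ in } D .$$ The characteristics of this equation over $y\in\bar Y$ are the solutions $(x,p,q,z)$ of $$\dot x=w(x)\tfrac{p}{|p|},\quad \dot p=-\nabla w(x)\,|p|,\quad \dot q=0,\quad \dot z=w(x)\tfrac{p}{|p|}\cdot p+q,$$ $$x(0)=y,\quad p(0)=\nabla\Phi_0(y),\quad q(0)=-w(y)|\nabla\Phi_0(y)|,\quad z(0)=\Phi_0(y),$$ with $x(s)\in\bar Y$, where $p/|p|$ is read as $0$ if $p=0$. **Statement.** Let $v_n\in C^{4,1}(\bar Y,\mathbb R)$. Let $\Phi_0\in C^4(\bar Y,\mathbb R)$ be a regular level-set function associated to $\Gamma$ (of class $C^4$), and let $\mathcal P\subset Y$ be such that $Y\setminus\mathcal P$ is compact and $\bar{\mathcal P}=\{y\in\bar Y:\Phi_0(y)\le 0\}$. Fix an open neighbourhood $U$ of $\partial Y$ with $\bar U\cap\Gamma=\emptyset$. Call $w\in C^{4,1}(\bar Y,\mathbb R)$ a *localization* of $v_n$ on $N$, where $N\subset Y$ is an open neighbourhood of $\Gamma$, if $w=v_n$ on $N$ and $w$ vanishes on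 $U\cap\bar Y$ and in a neighbourhood of $\{y\in\bar Y:\nabla\Phi_0(y)=0\}$. Then there is a localization of $v_n$ on some $N$, and for every $N$ and every localization $w$ of $v_n$ on $N$ there are $T>0$, a function $\Phi:[0,T]\times\bar Y\to\mathbb R$ and a family of maps $h_t:\bar Y\to\bar Y$, $t\in[0,T]$, such that the following holds. 1. $\Phi$ is a solution on $[0,T]\times\bar Y$ of the level-set equation with velocity $w$, and for every $T'\in(0,T]$ it is on $[0,T']\times\bar Y$ the only one. 2. Near the interface $\Phi$ is the local solution for the given velocity $v_n$: $\Phi$ is a solution on $[0,T]\times N$ of the level-set equation with velocity $v_n$, $\{y\in Y:\Phi(t,y)=0\}\subset N$ for all $t\in[0,T]$, and if $\Psi$ is any solution on $[0,T']\times N$ with velocity $v_n$, $T'\in(0,T]$, then there are $T''\in(0,T']$ and an open $N'$ with $\Gamma\subset N'\subset N$ such that $\{y\in Y:\Phi(t,y)=0\}\subset N'$ and $\Psi(t,\cdot)=\Phi(t,\cdot)$ on $N'$ for all $t\in[0,T'']$. 3. $h$ is induced by the characteristics of the solution: for every $y\in\bar Y$ there are $p,q,z$ such that $(h_t(y),p(t),q(t),z(t))$,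 $t\in[0,T]$, is a characteristic over $y$ for the velocity $w$, and $z(t)=\Phi(t,h_t(y))$, $p(t)=\nabla_y\Phi(t,h_t(y))$, $q(t)=\partial_t\Phi(t,h_t(y))$. 4. $h$ is a $C^1$-path in $\mathrm{Diff}^{2,1}_\Box(\bar Y)$ with $h_0=\mathrm{id}$: $h_t\in\mathrm{Diff}^{2,1}_\Box(\bar Y)$ for all $t\in[0,T]$, and $t\mapsto h_t$ is continuously differentiable on $[0,T]$ with respect to the norm of $C^{2,1}(\bar Y,\mathbb R^d)$. 5. $h_t(\bar{\mathcal P})=\{y\in\bar Y:\Phi(t,y)\le 0\}$ for all $t\in[0,T]$. -/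

import Mathlib

open Set Filter Topology
open scoped NNReal ENNReal

noncomputable section

/-- `d`-dimensional Euclidean space. -/
abbrev Eucl (d : ℕ) : Type := EuclideanSpace ℝ (Fin d)

/-- The open unit cell `Y = (-1/2, 1/2)^d`. Its closure is `closure (cell d)`, and its exterior
boundary is `frontier (cell d)`. -/
def cell (d : ℕ) : Set (Eucl d) := {y | ∀ i, y i ∈ Ioo (-(1 / 2) : ℝ) (1 / 2)}

section Hoelder

variable {E F : Type*} [NormedAddCommGroup E] [NormedSpace ℝ E]
  [NormedAddCommGroup F] [NormedSpace ℝ F]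

/-- `f ∈ C^{k,α}(s)`: `f` is `k` times continuously differentiable on `s` and its `k`-th derivative
is `α`-Hölder continuous on `s` (for `α = 1`: Lipschitz). For the closed cell the derivatives are
those relative to the closed cell. -/
def IsHoelderClass (k : ℕ) (α : ℝ≥0) (s : Set E) (f : E → F) : Prop :=
  ContDiffOn ℝ k f s ∧ ∃ C : ℝ≥0, HolderOnWith C α (iteratedFDerivWithin ℝ k f s) s

/-- The (extended) `C^{k,α}(s)`-norm: the maximum of the sup-norms of the derivatives of order at
most `k`, plus the `α`-Hölder seminorm of the `k`-th derivative. -/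
def hoelderENorm (k : ℕ) (α : ℝ≥0) (s : Set E) (f : E → F) : ℝ≥0∞ :=
  (⨆ j : ℕ, ⨆ _ : j ≤ k, ⨆ x ∈ s, ‖iteratedFDerivWithin ℝ j f s x‖ₑ) +
    ⨆ x ∈ s, ⨆ y ∈ s,
      edist (iteratedFDerivWithin ℝ k f s x) (iteratedFDerivWithin ℝ k f s y) /
        edist x y ^ (α : ℝ)

/-- `t ↦ h t`, `t ∈ [0, T]`, is a continuously differentiable path in the normed space `C^{k,α}(s)`:
the difference quotients converge in the `C^{k,α}(s)`-norm (one-sidedly at the end points) to a path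
`h'` in `C^{k,α}(s)` that is continuous for the `C^{k,α}(s)`-norm. -/
def IsC1Path (k : ℕ) (α : ℝ≥0) (s : Set E) (T : ℝ) (h : ℝ → E → F) : Prop :=
  (∀ t ∈ Icc 0 T, IsHoelderClass k α s (h t)) ∧
  ∃ h' : ℝ → E → F, (∀ t ∈ Icc 0 T, IsHoelderClass k α s (h' t)) ∧
    (∀ t ∈ Icc 0 T, Tendsto
      (fun r => hoelderENorm k α s (fun y => (r - t)⁻¹ • (h r y - h t y) - h' t y))
      (𝓝[Icc 0 T \ {t}] t) (𝓝 0)) ∧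
    (∀ t ∈ Icc 0 T, Tendsto
      (fun r => hoelderENorm k α s (fun y => h' r y - h' t y)) (𝓝[Icc 0 T] t) (𝓝 0))

end Hoelder

section Geometry

variable {d : ℕ}

/-- `h` restricts to a diffeomorphism of class `Diff^{k,α}` of the closed unit cell onto itself
which is the identity on the part of the closed cell in `U`; for a neighbourhood `U` of the exterior
boundary this is the class `Diff_□^{k,α}` of the closed cell. -/
def IsDiffBox (k : ℕ) (α : ℝ≥0) (U : Set (Eucl d)) (h : Eucl d → Eucl d) : Prop :=
  BijOn h (closure (cell d)) (closure (cell d)) ∧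
  IsHoelderClass k α (closure (cell d)) h ∧
  (∃ g : Eucl d → Eucl d, InvOn g h (closure (cell d)) (closure (cell d)) ∧
    IsHoelderClass k α (closure (cell d)) g) ∧
  ∀ y ∈ U ∩ closure (cell d), h y = y

/-- `ρ` is a `C^{k,α}` defining function of the set `O` on the open set `V`. -/
structure IsDefiningFunction (k : ℕ) (α : ℝ≥0) (O V : Set (Eucl d)) (ρ : Eucl d → ℝ) : Prop where
  isOpen : IsOpen V
  regular : IsHoelderClass k α V ρ
  gradient_ne : ∀ y ∈ V, gradient ρ y ≠ 0
  inside : ∀ y ∈ V, y ∈ O ↔ ρ y < 0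
  boundary : ∀ y ∈ V, y ∈ frontier O ↔ ρ y = 0

/-- `O` is an open set with boundary of class `C^{k,α}`. -/
def IsOpenOfClass (k : ℕ) (α : ℝ≥0) (O : Set (Eucl d)) : Prop :=
  IsOpen O ∧ ∀ x ∈ frontier O, ∃ V : Set (Eucl d), x ∈ V ∧ ∃ ρ, IsDefiningFunction k α O V ρ

/-- `ν` is the outer unit normal of the (at least `C^1`) open set `O` at its boundary point `x`:
the normalized gradient of a local `C^1` defining function. -/
def IsOuterUnitNormal (O : Set (Eucl d)) (x ν : Eucl d) : Prop :=
  x ∈ frontier O ∧ ∃ V : Set (Eucl d), x ∈ V ∧ ∃ ρ, IsDefiningFunction 1 0 O V ρ ∧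
    ν = ‖gradient ρ x‖⁻¹ • gradient ρ x

/-- `Φ` is a regular level-set function of class `C^{k,α}` associated to `Γ`: the set `Γ` is the
boundary of an open set `O` of class `C^{k,α}` compactly contained in the cell, `Γ` is the zero set
of `Φ` in the cell, and `∇Φ = -ν` on `Γ` with the outer unit normal `ν` of `O`. -/
def IsRegularLevelSetFunction (k : ℕ) (α : ℝ≥0) (Γ : Set (Eucl d)) (Φ : Eucl d → ℝ) : Prop :=
  IsHoelderClass k α (cell d) Φ ∧
  ∃ O : Set (Eucl d), IsOpenOfClass k α O ∧ IsCompact (closure O) ∧ closure O ⊆ cell d ∧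
    Γ = frontier O ∧ Γ = {y ∈ cell d | Φ y = 0} ∧
    ∀ y ∈ Γ, IsOuterUnitNormal O y (-gradient Φ y)

/-- `Φ` is a classical (`C^2`) solution on `[0, T] × D` of the level-set equation
`∂ₜΦ + v |∇Φ| = 0`, `Φ(0,·) = Φ₀`; the equation holds at all inner points. -/
structure IsLevelSetSolution (v Φ₀ : Eucl d → ℝ) (T : ℝ) (D : Set (Eucl d))
    (Φ : ℝ → Eucl d → ℝ) : Prop where
  contDiffOn : ContDiffOn ℝ 2 (fun q : ℝ × Eucl d => Φ q.1 q.2) (Icc 0 T ×ˢ D)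
  initial : ∀ y ∈ D, Φ 0 y = Φ₀ y
  equation : ∀ t ∈ Ioo 0 T, ∀ y ∈ interior D,
    deriv (fun r => Φ r y) t + v y * ‖gradient (Φ t) y‖ = 0

/-- `(x, p, q, z)` on `[0, T]` is the characteristic curve of the level-set equation
`q + v |p| = 0` (`p` is the spatial and `q` the temporal gradient variable, `z` the value, and the
time coordinate is the curve parameter) that starts over `y` with the data prescribed by `Φ₀`.
Since `x` has values in the closed cell, the gradients are those relative to the closed cell. At
`p = 0` the direction `p / |p|` is read as `0`. -/
structure IsCharacteristic (v Φ₀ : Eucl d → ℝ) (T : ℝ) (y : Eucl d)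
    (x p : ℝ → Eucl d) (q z : ℝ → ℝ) : Prop where
  mem : ∀ s ∈ Icc 0 T, x s ∈ closure (cell d)
  x_zero : x 0 = y
  p_zero : p 0 = gradientWithin Φ₀ (closure (cell d)) y
  q_zero : q 0 = -(v y * ‖gradientWithin Φ₀ (closure (cell d)) y‖)
  z_zero : z 0 = Φ₀ y
  x_ode : ∀ s ∈ Icc 0 T, HasDerivWithinAt x (v (x s) • (‖p s‖⁻¹ • p s)) (Icc 0 T) s
  p_ode : ∀ s ∈ Icc 0 T,
    HasDerivWithinAt p (-(‖p s‖ • gradientWithin v (closure (cell d)) (x s))) (Icc 0 T) s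
  q_ode : ∀ s ∈ Icc 0 T, HasDerivWithinAt q 0 (Icc 0 T) s
  z_ode : ∀ s ∈ Icc 0 T,
    HasDerivWithinAt z (v (x s) * inner ℝ (‖p s‖⁻¹ • p s) (p s) + q s) (Icc 0 T) s

/-- `w` is a localization at the interface `Γ` of the normal velocity `v`: it has the same
regularity, it agrees with `v` on the neighbourhood `N` of `Γ`, and it vanishes on the neighbourhood
`U` of the exterior boundary and near the critical points of `Φ₀`. -/
structure IsLocalizedVelocity (v Φ₀ : Eucl d → ℝ) (Γ U N : Set (Eucl d))
    (w : Eucl d → ℝ) : Prop where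
  regular : IsHoelderClass 4 1 (closure (cell d)) w
  isOpen_nhd : IsOpen N
  subset_nhd : Γ ⊆ N
  nhd_subset : N ⊆ cell d
  eq_on_nhd : ∀ y ∈ N, w y = v y
  zero_boundary : ∀ y ∈ U ∩ closure (cell d), w y = 0
  zero_critical : ∃ W : Set (Eucl d), IsOpen W ∧
    {y ∈ closure (cell d) | gradientWithin Φ₀ (closure (cell d)) y = 0} ⊆ W ∧
    ∀ y ∈ W ∩ closure (cell d), w y = 0

end Geometry

end

/-!
Short-time evolution of an interface by the level-set equation `∂ₜΦ + w |∇Φ| = 0` with a localized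
velocity `w`, by the method of characteristics.

*Characteristics.* The Hamiltonian of the equation is `H(x, p) = w(x)|p|`. A localized velocity
vanishes near the exterior boundary and near the critical points of `Φ₀`, so that it extends by zero
to a compactly supported `C⁴` function, and `|∇Φ₀|` is bounded above and away from zero on its
support. For a short time the momenta over this support stay in an annulus, where `|p|` can be
replaced by a smooth compactly supported function; hence the characteristic system is an ordinary
differential equation with a compactly supported `C³` right-hand side. Its flow is jointly `C³` in
time and initial value (`exists_contDiffOn_flow`): the rescaled integral equation on `C([0, 1])` has
a unique solution, its left-hand side is smooth because superposition operators are, and the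
implicit function theorem applies. The positions `h_t` start at the identity and are therefore
diffeomorphisms for a short time, with jointly `C³` inverse (`exists_contDiffOn_inverse`). Joint
`C³` smoothness of `h` and of its time derivative on a convex compact set makes `h` a `C¹` path in
`C^{2,1}` (`isC1Path_of_contDiffOn`): derivatives of order at most three of the difference quotients
converge uniformly, and the third derivative bounds the Lipschitz seminorm of the second.

*The solution.* As `H` is homogeneous of degree one in `p`, the value `z` is constant along
characteristics, so that the solution is `Φ(t, ·) = Φ₀ ∘ h_t⁻¹` (`transportedLevelSet`). Its
gradient along characteristics is the momentum, because `⟨∂ₑh_t, p⟩` is conserved for every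
direction `e` (`exists_isCharacteristicFlow`); since `H` is conserved as well, `∂ₜΦ = -w |∇Φ|`
(`IsCharacteristicFlow.isLevelSetSolution`). The statements on sublevel sets and on the zero set are
immediate from `Φ(t, h_t(y)) = Φ₀(y)`.

*Uniqueness.* The difference `u` of two solutions satisfies `|∂ₜu| ≤ C |∇u|` with `C = sup |w|`, and
such functions obey a maximum principle on sets that are closed under moving backwards in time with
speed at most `C` (`nonpos_of_deriv_le_mul_norm_gradient`). On backward cones this gives local
uniqueness near the interface; on the whole cell the vanishing of `w` near the exterior boundary
makes the two solutions agree there, and replaces the condition at these points.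

*Localizations* are products of the velocity with a smooth cut-off function: the classes `C^{k,1}`
of a compact convex set are stable under products (`exists_isLocalizedVelocity`).
-/

/-! ### Smooth dependence of flows on time and initial value -/

/-- A globally unique solution `s` of the equation `G (a, s a) = G (a₀, s a₀)` is as smooth as `G`,
as soon as the implicit function theorem applies at the base point: no continuity of `s` is
required. -/
theorem contDiffAt_of_unique_implicit {A B C : Type*}
    [NormedAddCommGroup A] [NormedSpace ℝ A] [CompleteSpace A]
    [NormedAddCommGroup B] [NormedSpace ℝ B] [CompleteSpace B]
    [NormedAddCommGroup C] [NormedSpace ℝ C] [CompleteSpace C]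
    {G : A × B → C} {s : A → B} {a₀ : A} {n : WithTop ℕ∞} (hn : n ≠ 0)
    (hG : ContDiffAt ℝ n G (a₀, s a₀))
    (hinv : (fderiv ℝ G (a₀, s a₀) ∘L .inr ℝ A B).IsInvertible)
    (huniq : ∀ᶠ a in 𝓝 a₀, ∀ b, G (a, b) = G (a₀, s a₀) → b = s a) :
    ContDiffAt ℝ n s a₀ := by
  have h1 := hG.contDiffAt_implicitFunction hn hinv
  have h2 := hG.eventually_apply_implicitFunction hn hinv
  refine h1.congr_of_eventuallyEq ?_
  filter_upwards [h2, huniq] with a ha hu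
  exact (hu _ ha).symm

section Superposition

variable {K : Type*} [TopologicalSpace K] [CompactSpace K]

/-- Pointwise application of a continuous family of operators to a continuous map, as a bounded
bilinear map. -/
noncomputable def continuousMapApply (K E G : Type*) [TopologicalSpace K] [CompactSpace K]
    [NormedAddCommGroup E] [NormedSpace ℝ E] [NormedAddCommGroup G] [NormedSpace ℝ G] :
    C(K, E →L[ℝ] G) →L[ℝ] C(K, E) →L[ℝ] C(K, G) :=
  LinearMap.mkContinuous₂
    (LinearMap.mk₂ ℝ (fun (A : C(K, E →L[ℝ] G)) (v : C(K, E)) =>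
        (⟨fun s => A s (v s), by fun_prop⟩ : C(K, G)))
      (fun _ _ _ => by ext; simp) (fun _ _ _ => by ext; simp)
      (fun _ _ _ => by ext; simp) (fun _ _ _ => by ext; simp)) 1
    (fun A v => by
      rw [ContinuousMap.norm_le _ (by positivity)]
      intro s
      calc ‖A s (v s)‖ ≤ ‖A s‖ * ‖v s‖ := (A s).le_opNorm _
        _ ≤ ‖A‖ * ‖v‖ := by gcongr <;> exact ContinuousMap.norm_coe_le_norm _ _
        _ = 1 * ‖A‖ * ‖v‖ := by ring)

@[simp]
theorem continuousMapApply_apply {E G : Type*}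
    [NormedAddCommGroup E] [NormedSpace ℝ E] [NormedAddCommGroup G] [NormedSpace ℝ G]
    (A : C(K, E →L[ℝ] G)) (v : C(K, E)) (s : K) : continuousMapApply K E G A v s = A s (v s) := rfl

theorem norm_continuousMapApply_le {E G : Type*}
    [NormedAddCommGroup E] [NormedSpace ℝ E] [NormedAddCommGroup G] [NormedSpace ℝ G]
    (A : C(K, E →L[ℝ] G)) : ‖continuousMapApply K E G A‖ ≤ ‖A‖ := by
  refine ContinuousLinearMap.opNorm_le_bound _ (norm_nonneg A) fun v => ?_
  rw [ContinuousMap.norm_le _ (by positivity)]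
  intro s
  calc ‖A s (v s)‖ ≤ ‖A s‖ * ‖v s‖ := (A s).le_opNorm _
    _ ≤ ‖A‖ * ‖v‖ := by gcongr <;> exact ContinuousMap.norm_coe_le_norm _ _

/-- The superposition operator `u ↦ F ∘ u` on continuous maps of a compact space is differentiable
if `F` is `C¹`: the remainder is controlled by the modulus of continuity of `DF` along `u`, which is
uniform because `u ↦ DF ∘ u` is continuous. -/
theorem hasFDerivAt_superposition {E G : Type*}
    [NormedAddCommGroup E] [NormedSpace ℝ E] [NormedAddCommGroup G] [NormedSpace ℝ G]
    {F : C(E, G)} (hF : ContDiff ℝ 1 F) (u : C(K, E)) :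
    HasFDerivAt (fun u : C(K, E) => F.comp u)
      (continuousMapApply K E G
        ((⟨fderiv ℝ F, hF.continuous_fderiv one_ne_zero⟩ : C(E, E →L[ℝ] G)).comp u)) u := by
  set F' : C(E, E →L[ℝ] G) := ⟨fderiv ℝ F, hF.continuous_fderiv one_ne_zero⟩
  rw [hasFDerivAt_iff_isLittleO_nhds_zero, Asymptotics.isLittleO_iff]
  intro ε hε
  have hc : Continuous fun u : C(K, E) => F'.comp u := ContinuousMap.continuous_postcomp F'
  obtain ⟨δ, hδ, hb⟩ := (Metric.continuous_iff (f := fun u : C(K, E) => F'.comp u)).1 hc u ε hε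
  filter_upwards [Metric.ball_mem_nhds (0 : C(K, E)) hδ] with v hv
  rw [ContinuousMap.norm_le _ (by positivity)]
  intro s
  have key : ∀ z ∈ Metric.closedBall (u s) ‖v‖,
      ‖fderiv ℝ F z - fderiv ℝ F (u s)‖ ≤ ε := by
    intro z hz
    have h1 := hb (u + ContinuousMap.const K (z - u s)) (by
      rw [dist_eq_norm, add_sub_cancel_left]
      refine lt_of_le_of_lt ?_ (mem_ball_zero_iff.1 hv)
      rw [ContinuousMap.norm_le _ (norm_nonneg _)]
      intro x
      simpa [dist_eq_norm] using hz)
    have h2 := (ContinuousMap.dist_apply_le_dist s).trans h1.le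
    simpa [F', dist_eq_norm] using h2
  have hmv := (convex_closedBall (u s) ‖v‖).norm_image_sub_le_of_norm_hasFDerivWithin_le'
    (f := F) (f' := fderiv ℝ F) (φ := fderiv ℝ F (u s)) (C := ε)
    (x := u s) (y := u s + v s)
    (fun z _ => (hF.differentiable one_ne_zero z).hasFDerivAt.hasFDerivWithinAt) key
    (Metric.mem_closedBall_self (norm_nonneg _))
    (by simpa [Metric.mem_closedBall, dist_eq_norm] using ContinuousMap.norm_coe_le_norm v s)
  calc ‖(F.comp (u + v) - F.comp u - continuousMapApply K E G (F'.comp u) v) s‖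
      = ‖F (u s + v s) - F (u s) - fderiv ℝ F (u s) (u s + v s - u s)‖ := by simp [F']
    _ ≤ ε * ‖u s + v s - u s‖ := hmv
    _ ≤ ε * ‖v‖ := by
        rw [add_sub_cancel_left]
        gcongr
        exact ContinuousMap.norm_coe_le_norm _ _

/-- The superposition operator of a `C^k` map is `C^k`. -/
theorem contDiff_superposition.{u, v} {K : Type u} [TopologicalSpace K] [CompactSpace K]
    {E : Type v} [NormedAddCommGroup E] [NormedSpace ℝ E] (k : ℕ) :
    ∀ {G : Type v} [NormedAddCommGroup G] [NormedSpace ℝ G] {F : C(E, G)}, ContDiff ℝ k F →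
      ContDiff ℝ k (fun u : C(K, E) => F.comp u) := by
  induction k with
  | zero =>
    intro G _ _ F _
    exact contDiff_zero.2 (ContinuousMap.continuous_postcomp F)
  | succ k ih =>
    intro G _ _ F hF
    have h1 : ContDiff ℝ 1 F := hF.of_le (by exact_mod_cast Nat.le_add_left 1 k)
    have h2 : ContDiff ℝ k (fderiv ℝ F) := hF.fderiv_right (by norm_cast)
    have h3 := (continuousMapApply K E G).contDiff.comp
      (ih (F := ⟨fderiv ℝ F, h1.continuous_fderiv one_ne_zero⟩) h2)
    rw [Nat.cast_succ, contDiff_succ_iff_hasFDerivAt]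
    exact ⟨_, h3, fun u => hasFDerivAt_superposition h1 u⟩

end Superposition

theorem isInvertible_id_sub {E : Type*} [NormedAddCommGroup E] [NormedSpace ℝ E] [CompleteSpace E]
    {t : E →L[ℝ] E} (ht : ‖t‖ < 1) : (ContinuousLinearMap.id ℝ E - t).IsInvertible := by
  obtain ⟨u, hu⟩ := isUnit_one_sub_of_norm_lt_one ht
  refine ContinuousLinearMap.IsInvertible.of_inverse (g := (↑u⁻¹ : E →L[ℝ] E)) ?_ ?_
  · change (1 - t) * _ = 1
    rw [← hu, Units.mul_inv]
  · change _ * (1 - t) = 1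
    rw [← hu, Units.inv_mul]

section Integration

theorem continuous_comp_projIcc {E : Type*} [NormedAddCommGroup E] (u : C(Icc (0 : ℝ) 1, E)) :
    Continuous fun r => u (projIcc 0 1 zero_le_one r) :=
  u.continuous.comp continuous_projIcc

variable {E : Type*} [NormedAddCommGroup E] [NormedSpace ℝ E]

/-- The integration operator `u ↦ (s ↦ ∫₀ˢ u)` on continuous curves over `[0, 1]`. -/
noncomputable def integralCLM (E : Type*) [NormedAddCommGroup E] [NormedSpace ℝ E] :
    C(Icc (0 : ℝ) 1, E) →L[ℝ] C(Icc (0 : ℝ) 1, E) :=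
  LinearMap.mkContinuous
    { toFun := fun u =>
        ⟨fun s => ∫ r in (0 : ℝ)..s, u (projIcc 0 1 zero_le_one r),
          (intervalIntegral.continuous_primitive
            (fun _ _ => (continuous_comp_projIcc u).intervalIntegrable _ _) 0).comp
            continuous_subtype_val⟩
      map_add' := fun u v => by
        ext s
        exact intervalIntegral.integral_add ((continuous_comp_projIcc u).intervalIntegrable _ _)
          ((continuous_comp_projIcc v).intervalIntegrable _ _)
      map_smul' := fun c u => by
        ext s
        exact intervalIntegral.integral_smul c _ } 1
    (fun u => by
      rw [ContinuousMap.norm_le _ (by positivity)]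
      intro s
      have := intervalIntegral.norm_integral_le_of_norm_le_const (a := (0 : ℝ)) (b := s)
        (f := fun r => u (projIcc 0 1 zero_le_one r)) (C := ‖u‖)
        (fun r _ => ContinuousMap.norm_coe_le_norm _ _)
      refine this.trans ?_
      rw [sub_zero, abs_of_nonneg s.2.1, one_mul]
      exact mul_le_of_le_one_right (norm_nonneg _) s.2.2)

theorem integralCLM_apply (u : C(Icc (0 : ℝ) 1, E)) (s : Icc (0 : ℝ) 1) :
    integralCLM E u s = ∫ r in (0 : ℝ)..s, u (projIcc 0 1 zero_le_one r) := rfl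

theorem norm_integralCLM_le : ‖integralCLM E‖ ≤ 1 :=
  LinearMap.mkContinuous_norm_le _ zero_le_one _

end Integration

/-- The constant curves, as a bounded linear map. -/
noncomputable def constCurve (E : Type*) [NormedAddCommGroup E] [NormedSpace ℝ E] :
    E →L[ℝ] C(Icc (0 : ℝ) 1, E) :=
  LinearMap.mkContinuous
    { toFun := fun y => ContinuousMap.const _ y
      map_add' := fun _ _ => rfl
      map_smul' := fun _ _ => rfl } 1
    (fun y => by
      rw [ContinuousMap.norm_le _ (by positivity)]
      intro s
      rw [one_mul]
      exact le_rfl)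

/-- The integral form of the rescaled initial value problem `u' = σ F(u)`, `u(0) = y` on `[0, 1]`:
the zeros in `u` of this map are its solutions. -/
noncomputable def flowEquation {E : Type*} [NormedAddCommGroup E] [NormedSpace ℝ E] (F : C(E, E))
    (a : (ℝ × E) × C(Icc (0 : ℝ) 1, E)) : C(Icc (0 : ℝ) 1, E) :=
  a.2 - constCurve E a.1.2 - a.1.1 • integralCLM E (F.comp a.2)

section FlowEquation

variable {E : Type*} [NormedAddCommGroup E] [NormedSpace ℝ E] {F : C(E, E)} {L : ℝ≥0}

theorem contDiff_flowEquation {k : ℕ} (hF : ContDiff ℝ k F) : ContDiff ℝ k (flowEquation F) := by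
  have h1 : ContDiff ℝ k fun a : (ℝ × E) × C(Icc (0 : ℝ) 1, E) => F.comp a.2 :=
    (contDiff_superposition k hF).comp contDiff_snd
  have h2 : ContDiff ℝ k fun a : (ℝ × E) × C(Icc (0 : ℝ) 1, E) => constCurve E a.1.2 :=
    (constCurve E).contDiff.comp contDiff_fst.snd
  have h3 : ContDiff ℝ k fun a : (ℝ × E) × C(Icc (0 : ℝ) 1, E) => integralCLM E (F.comp a.2) :=
    (integralCLM E).contDiff.comp h1
  exact (contDiff_snd.sub h2).sub (contDiff_fst.fst.smul h3)

theorem isInvertible_fderiv_flowEquation [CompleteSpace E] (hF : ContDiff ℝ 1 F)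
    (hL : LipschitzWith L F) {σ : ℝ} (hσ : |σ| * L < 1) (y : E) (u : C(Icc (0 : ℝ) 1, E)) :
    (fderiv ℝ (flowEquation F) ((σ, y), u) ∘L .inr ℝ (ℝ × E) C(Icc (0 : ℝ) 1, E)).IsInvertible := by
  set A := continuousMapApply (Icc (0 : ℝ) 1) E E
        ((⟨fderiv ℝ F, hF.continuous_fderiv one_ne_zero⟩ : C(E, E →L[ℝ] E)).comp u) with hA
  have h1 : HasFDerivAt (flowEquation F) (fderiv ℝ (flowEquation F) ((σ, y), u)) ((σ, y), u) :=
    ((contDiff_flowEquation (k := 1) hF).differentiable one_ne_zero _).hasFDerivAt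
  have h2 := h1.comp u (hasFDerivAt_prodMk_right (σ, y) u)
  have h3 : HasFDerivAt (fun u => flowEquation F ((σ, y), u))
      (.id ℝ _ - σ • (integralCLM E ∘L A)) u := by
    have := ((hasFDerivAt_id (𝕜 := ℝ) u).sub_const (constCurve E y)).sub
      (((integralCLM E).hasFDerivAt.comp u (hasFDerivAt_superposition hF u)).const_smul σ)
    exact this
  have h4 := h2.unique h3
  rw [h4]
  refine isInvertible_id_sub (lt_of_le_of_lt ?_ hσ)
  rw [norm_smul, Real.norm_eq_abs]
  gcongr
  have hA' : ‖A‖ ≤ L := by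
    refine (norm_continuousMapApply_le _).trans ?_
    rw [ContinuousMap.norm_le _ L.coe_nonneg]
    intro s
    exact norm_fderiv_le_of_lipschitz ℝ hL
  calc ‖integralCLM E ∘L A‖ ≤ ‖integralCLM E‖ * ‖A‖ := ContinuousLinearMap.opNorm_comp_le _ _
    _ ≤ 1 * L := by gcongr; exact norm_integralCLM_le
    _ = L := one_mul _

theorem eq_of_flowEquation_eq_zero (hL : LipschitzWith L F) {σ : ℝ} (hσ : |σ| * L < 1) {y : E}
    {u v : C(Icc (0 : ℝ) 1, E)} (hu : flowEquation F ((σ, y), u) = 0)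
    (hv : flowEquation F ((σ, y), v) = 0) : u = v := by
  have h1 : u - v = σ • integralCLM E (F.comp u - F.comp v) := by
    rw [map_sub, smul_sub]
    simp only [flowEquation] at hu hv
    rw [sub_eq_zero] at hu hv
    rw [← hu, ← hv]
    abel
  have h2 : ‖F.comp u - F.comp v‖ ≤ L * ‖u - v‖ := by
    rw [ContinuousMap.norm_le _ (by positivity)]
    intro s
    have := hL.dist_le_mul (u s) (v s)
    rw [dist_eq_norm, dist_eq_norm] at this
    refine this.trans ?_
    gcongr
    exact ContinuousMap.norm_coe_le_norm (u - v) s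
  have h3 : ‖u - v‖ ≤ |σ| * L * ‖u - v‖ := by
    calc ‖u - v‖ = |σ| * ‖integralCLM E (F.comp u - F.comp v)‖ := by
          rw [← Real.norm_eq_abs, ← norm_smul, ← h1]
      _ ≤ |σ| * (1 * (L * ‖u - v‖)) := by
          gcongr
          exact ((integralCLM E).le_opNorm _).trans
            (mul_le_mul norm_integralCLM_le h2 (norm_nonneg _) zero_le_one)
      _ = |σ| * L * ‖u - v‖ := by ring
  have h4 : ‖u - v‖ = 0 := by nlinarith [norm_nonneg (u - v)]
  exact sub_eq_zero.1 (norm_eq_zero.1 h4)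

end FlowEquation

/-- A bounded, globally Lipschitz `C^k` vector field has a flow for short times, uniformly in the
initial value, and the flow is jointly `C^k` in time and initial value: up to rescaling of time it
is the solution of `flowEquation`, to which the implicit function theorem applies. -/
theorem exists_contDiffOn_flow {E : Type*} [NormedAddCommGroup E] [NormedSpace ℝ E]
    [CompleteSpace E] {k : ℕ} (hk : k ≠ 0) {F : E → E} (hF : ContDiff ℝ k F) {L M : ℝ≥0}
    (hL : LipschitzWith L F) (hM : ∀ x, ‖F x‖ ≤ M) :
    ∃ τ > 0, ∃ X : ℝ → E → E, (∀ y, X 0 y = y) ∧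
      (∀ t ∈ Ioo (-τ) τ, ∀ y, HasDerivAt (fun r => X r y) (F (X t y)) t) ∧
      ContDiffOn ℝ k (fun a : ℝ × E => X a.1 a.2) (Ioo (-τ) τ ×ˢ univ) := by
  -- for `|σ| < τ` the integral equation is a contraction, so its solution is unique
  set τ : ℝ := (L + 1 : ℝ)⁻¹ with hτ
  have hτ0 : 0 < τ := by positivity
  have hτ1 : τ * (L + 1) = 1 := inv_mul_cancel₀ (by positivity)
  clear_value τ
  have h0 : (0 : ℝ) ∈ Icc (-τ) τ := ⟨by linarith, hτ0.le⟩
  have hτL : ∀ σ ∈ Ioo (-τ) τ, |σ| * L < 1 := by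
    intro σ hσ
    have h1 : |σ| ≤ τ := (abs_lt.2 hσ).le
    calc |σ| * L ≤ τ * L := by gcongr
      _ < τ * (L + 1) := by gcongr; linarith
      _ = 1 := hτ1
  -- the existence time of Picard-Lindelöf does not depend on the initial value, as `F` is bounded
  have hPL : ∀ y : E, ∃ α : ℝ → E, α 0 = y ∧
      ∀ t ∈ Icc (-τ) τ, HasDerivWithinAt α (F (α t)) (Icc (-τ) τ) t := by
    intro y
    have : IsPicardLindelof (fun _ : ℝ => F) (tmin := -τ) (tmax := τ)
        ⟨0, h0⟩ y (M * τ.toNNReal) 0 M L :=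
      IsPicardLindelof.of_time_independent (fun x _ => hM x) hL.lipschitzOnWith
        (by simp [max_eq_left hτ0.le])
    exact this.exists_eq_forall_mem_Icc_hasDerivWithinAt₀
  choose α hα0 hα using hPL
  have hle : -τ ≤ τ := by linarith
  set X : ℝ → E → E := fun t y => α y (projIcc (-τ) τ hle t) with hX
  have hXα : ∀ t ∈ Icc (-τ) τ, ∀ y, X t y = α y t := by
    intro t ht y
    simp only [hX, projIcc_of_mem hle ht]
  have hXc : ∀ y, Continuous fun t => X t y := by
    intro y
    have h1 : ContinuousOn (α y) (Icc (-τ) τ) := fun t ht => (hα y t ht).continuousWithinAt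
    exact (continuousOn_iff_continuous_domRestrict.1 h1).comp continuous_projIcc
  have hXd : ∀ t ∈ Ioo (-τ) τ, ∀ y, HasDerivAt (fun r => X r y) (F (X t y)) t := by
    intro t ht y
    have hm := Icc_mem_nhds ht.1 ht.2
    rw [hXα t (Ioo_subset_Icc_self ht) y]
    refine ((hα y t (Ioo_subset_Icc_self ht)).hasDerivAt hm).congr_of_eventuallyEq ?_
    filter_upwards [hm] with r hr using hXα r hr y
  have hX0 : ∀ y, X 0 y = y := fun y => by
    rw [hXα 0 h0 y, hα0]
  refine ⟨τ, hτ0, X, hX0, hXd, ?_⟩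
  set Fc : C(E, E) := ⟨F, hL.continuous⟩
  -- the orbit of `y` up to time `σ`, reparametrized over `[0, 1]`
  set s : ℝ × E → C(Icc (0 : ℝ) 1, E) := fun a =>
    ⟨fun r => X (a.1 * r) a.2, (hXc a.2).comp (by fun_prop)⟩ with hs
  have hscale : ∀ σ ∈ Ioo (-τ) τ, ∀ r ∈ Icc (0 : ℝ) 1, σ * r ∈ Ioo (-τ) τ := by
    intro σ hσ r hr
    have h1 : |σ * r| < τ := by
      rw [abs_mul, abs_of_nonneg hr.1]
      exact lt_of_le_of_lt (mul_le_of_le_one_right (abs_nonneg _) hr.2) (abs_lt.2 hσ)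
    exact abs_lt.1 h1
  have hsol : ∀ σ ∈ Ioo (-τ) τ, ∀ y, flowEquation Fc ((σ, y), s (σ, y)) = 0 := by
    intro σ hσ y
    ext r
    have hI : ∫ x in (0 : ℝ)..r, σ • F (X (σ * x) y) = X (σ * r) y - X (σ * 0) y := by
      refine intervalIntegral.integral_eq_sub_of_hasDerivAt (f := fun x => X (σ * x) y) ?_ ?_
      · intro x hx
        rw [uIcc_of_le r.2.1] at hx
        have h1 := hXd (σ * x) (hscale σ hσ x ⟨hx.1, hx.2.trans r.2.2⟩) y
        have h2 : HasDerivAt (fun x : ℝ => σ * x) σ x := by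
          simpa using (hasDerivAt_id x).const_mul σ
        exact h1.scomp x h2
      · refine Continuous.intervalIntegrable ?_ _ _
        exact (hL.continuous.comp ((hXc y).comp (by fun_prop))).const_smul σ
    have hJ : integralCLM E (Fc.comp (s (σ, y))) r = ∫ x in (0 : ℝ)..r, F (X (σ * x) y) := by
      rw [integralCLM_apply]
      refine intervalIntegral.integral_congr fun x hx => ?_
      rw [uIcc_of_le r.2.1] at hx
      simp [Fc, hs, projIcc_of_mem zero_le_one
        (show x ∈ Icc (0 : ℝ) 1 from ⟨hx.1, hx.2.trans r.2.2⟩)]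
    have hv : flowEquation Fc ((σ, y), s (σ, y)) r =
        X (σ * r) y - y - σ • integralCLM E (Fc.comp (s (σ, y))) r := rfl
    rw [hv, hJ, ← intervalIntegral.integral_smul, hI, mul_zero, hX0]
    simp
  have hF1 : ContDiff ℝ 1 F := hF.of_le (by exact_mod_cast Nat.one_le_iff_ne_zero.2 hk)
  have hmain : ∀ a ∈ Ioo (-τ) τ ×ˢ (univ : Set E), ContDiffAt ℝ k s a := by
    rintro ⟨σ, y⟩ ⟨hσ, -⟩
    refine contDiffAt_of_unique_implicit (G := flowEquation Fc) (by exact_mod_cast hk)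
      (contDiff_flowEquation hF).contDiffAt
      (isInvertible_fderiv_flowEquation hF1 hL (hτL σ hσ) y _) ?_
    filter_upwards [(isOpen_Ioo.prod isOpen_univ).mem_nhds
      (show (σ, y) ∈ Ioo (-τ) τ ×ˢ (univ : Set E) from ⟨hσ, mem_univ _⟩)] with b hb u hu
    rw [hsol σ hσ y] at hu
    exact eq_of_flowEquation_eq_zero (F := Fc) hL (hτL b.1 hb.1) hu (hsol b.1 hb.1 b.2)
  intro a ha
  have h1 := ((ContinuousMap.evalCLM ℝ (⟨1, by simp⟩ : Icc (0 : ℝ) 1) :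
    C(Icc (0 : ℝ) 1, E) →L[ℝ] E).contDiff (n := k)).contDiffAt.comp a (hmain a ha)
  refine (h1.congr_of_eventuallyEq (Eventually.of_forall fun b => ?_)).contDiffWithinAt
  simp [hs]

/-! ### Geometry of the cell -/

section Cell

variable {d : ℕ}

theorem isOpen_cell : IsOpen (cell d) := by
  have : cell d = ⋂ i, {y : Eucl d | y i ∈ Ioo (-(1 / 2) : ℝ) (1 / 2)} := by
    ext y
    simp [cell]
  rw [this]
  refine isOpen_iInter_of_finite fun i => ?_
  exact isOpen_Ioo.preimage (by fun_prop)

theorem convex_cell : Convex ℝ (cell d) := by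
  intro x hx y hy a b ha hb hab i
  have := convex_Ioo (-(1 / 2) : ℝ) (1 / 2) (hx i) (hy i) ha hb hab
  simpa using this

theorem zero_mem_cell : (0 : Eucl d) ∈ cell d := fun i => by
  constructor <;> norm_num

theorem convex_closure_cell : Convex ℝ (closure (cell d)) := convex_cell.closure

theorem interior_closure_cell : interior (closure (cell d)) = cell d := by
  rw [convex_cell.interior_closure_eq_interior_of_nonempty_interior, isOpen_cell.interior_eq]
  rw [isOpen_cell.interior_eq]
  exact ⟨0, zero_mem_cell⟩

theorem uniqueDiffOn_closure_cell : UniqueDiffOn ℝ (closure (cell d)) :=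
  uniqueDiffOn_convex convex_closure_cell (by
    rw [interior_closure_cell]
    exact ⟨0, zero_mem_cell⟩)

theorem isCompact_closure_cell : IsCompact (closure (cell d)) := by
  refine Metric.isCompact_of_isClosed_isBounded isClosed_closure (Bornology.IsBounded.closure ?_)
  refine (Metric.isBounded_closedBall (x := (0 : Eucl d)) (r := √d)).subset fun y hy => ?_
  rw [mem_closedBall_zero_iff, EuclideanSpace.norm_eq]
  refine Real.sqrt_le_sqrt ?_
  calc ∑ i, ‖y i‖ ^ 2 ≤ ∑ _i : Fin d, (1 : ℝ) := by
        gcongr with i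
        refine pow_le_one₀ (norm_nonneg _) (abs_le.2 ⟨?_, ?_⟩) <;> linarith [(hy i).1, (hy i).2]
    _ = d := by simp

theorem closure_cell_nhds {y : Eucl d} (hy : y ∈ cell d) : closure (cell d) ∈ 𝓝 y :=
  mem_of_superset (isOpen_cell.mem_nhds hy) subset_closure

theorem mem_cell_of_notMem {U : Set (Eucl d)} (hUb : frontier (cell d) ⊆ U) {y : Eucl d}
    (hy : y ∈ closure (cell d)) (hyU : y ∉ U) : y ∈ cell d := by
  by_contra h
  refine hyU (hUb ⟨hy, ?_⟩)
  rwa [isOpen_cell.interior_eq]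

end Cell

/-! ### Finite speed of propagation and uniqueness -/

/-- A function that satisfies `∂ₜu ≤ C |∇u|` on a compact space-time set from which all directions
of speed at most `C` point backwards in time into the set is nonpositive, if it is so at the points
where these conditions fail. At a positive maximum of `u - ε t`, the derivative in the backward
direction of speed `C` along `∇u` would be positive. -/
theorem nonpos_of_deriv_le_mul_norm_gradient {E : Type*} [NormedAddCommGroup E]
    [InnerProductSpace ℝ E] {u : ℝ × E → ℝ} {S : Set (ℝ × E)} {C : ℝ} (hS : IsCompact S)
    (hu : ContinuousOn u S) (hS0 : ∀ a ∈ S, 0 ≤ a.1)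
    (h : ∀ a ∈ S, u a ≤ 0 ∨ ∃ (b : ℝ) (g : E),
      HasFDerivAt u (b • ContinuousLinearMap.fst ℝ ℝ E +
        innerSL ℝ g ∘L ContinuousLinearMap.snd ℝ ℝ E) a ∧ b ≤ C * ‖g‖ ∧
      ∀ e : E, ‖e‖ ≤ 1 → ∀ᶠ s in 𝓝[>] (0 : ℝ), (a.1 - s, a.2 + s • C • e) ∈ S) :
    ∀ a ∈ S, u a ≤ 0 := by
  have key : ∀ ε > 0, ∀ a ∈ S, u a ≤ ε * a.1 := by
    intro ε hε a ha
    obtain ⟨m, hm, hmax⟩ := hS.exists_isMaxOn ⟨a, ha⟩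
      (hu.sub ((continuous_fst.const_mul ε).continuousOn))
    have hle : u a - ε * a.1 ≤ u m - ε * m.1 := hmax ha
    suffices u m - ε * m.1 ≤ 0 by linarith
    rcases h m hm with h0 | ⟨b, g, hd, hb, hdir⟩
    · nlinarith [hS0 m hm]
    exfalso
    set e : E := ‖g‖⁻¹ • g with he
    have he1 : ‖e‖ ≤ 1 := by
      rw [he, norm_smul, norm_inv, norm_norm]
      exact inv_mul_le_one
    have hge : inner ℝ g e = ‖g‖ := by
      rw [he, real_inner_smul_right, real_inner_self_eq_norm_sq]
      by_cases hg : ‖g‖ = 0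
      · simp [hg]
      · field_simp
    have hγ : HasDerivAt (fun s : ℝ => (m.1 - s, m.2 + s • C • e)) ((-1 : ℝ), C • e) 0 := by
      refine HasDerivAt.prodMk ?_ ?_
      · simpa using (hasDerivAt_id (0 : ℝ)).const_sub m.1
      · simpa using ((hasDerivAt_id (0 : ℝ)).smul_const (C • e)).const_add m.2
    have hd' : HasFDerivAt u (b • ContinuousLinearMap.fst ℝ ℝ E +
        innerSL ℝ g ∘L ContinuousLinearMap.snd ℝ ℝ E)
        ((fun s : ℝ => (m.1 - s, m.2 + s • C • e)) 0) := by simpa using hd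
    have hφ : HasDerivAt (fun s : ℝ => u (m.1 - s, m.2 + s • C • e) - ε * (m.1 - s))
        (-b + C * ‖g‖ + ε) 0 := by
      refine ((hd'.comp_hasDerivAt (0 : ℝ) hγ).sub
        (((hasDerivAt_id (0 : ℝ)).const_sub m.1).const_mul ε)).congr_deriv ?_
      simp [hge]
    have hslope := (hasDerivWithinAt_iff_tendsto_slope' (self_notMem_Ioi (a := (0 : ℝ)))).1
      (hφ.hasDerivWithinAt (s := Ioi 0))
    have hle0 : -b + C * ‖g‖ + ε ≤ 0 := by
      refine le_of_tendsto hslope ?_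
      filter_upwards [hdir e he1, self_mem_nhdsWithin] with s hs hs0
      rw [slope_def_field]
      refine div_nonpos_of_nonpos_of_nonneg ?_ (by simpa using (le_of_lt hs0 : (0 : ℝ) ≤ s))
      have : u (m.1 - s, m.2 + s • C • e) - ε * (m.1 - s) ≤ u m - ε * m.1 := hmax hs
      simpa using this
    linarith
  intro a ha
  refine le_of_forall_pos_le_add fun ε hε => ?_
  have h1 : 0 ≤ a.1 := hS0 a ha
  have := key (ε / (a.1 + 1)) (by positivity) a ha
  have h2 : ε / (a.1 + 1) * a.1 ≤ ε := by
    rw [div_mul_eq_mul_div, div_le_iff₀ (by positivity)]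
    nlinarith
  linarith

section Solutions

variable {d : ℕ} {v Φ₀ : Eucl d → ℝ} {T : ℝ} {D : Set (Eucl d)} {Ψ Ψ' : ℝ → Eucl d → ℝ}

/-- The space-time derivative of a function on space-time, in terms of its time derivative and its
spatial gradient. -/
theorem hasFDerivAt_of_differentiableAt_prod {Ψ : ℝ → Eucl d → ℝ} {t : ℝ} {y : Eucl d}
    (h : DifferentiableAt ℝ (fun q : ℝ × Eucl d => Ψ q.1 q.2) (t, y)) :
    HasFDerivAt (fun q : ℝ × Eucl d => Ψ q.1 q.2)
      (deriv (fun r => Ψ r y) t • ContinuousLinearMap.fst ℝ ℝ (Eucl d) +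
        innerSL ℝ (gradient (Ψ t) y) ∘L ContinuousLinearMap.snd ℝ ℝ (Eucl d)) (t, y) := by
  have h0 := h.hasFDerivAt
  set A := fderiv ℝ (fun q : ℝ × Eucl d => Ψ q.1 q.2) (t, y)
  have h1 : HasFDerivAt (Ψ t) (A ∘L .inr ℝ ℝ (Eucl d)) y :=
    h0.comp y (hasFDerivAt_prodMk_right t y)
  have h2 : HasDerivAt (fun r => Ψ r y) (A (1, 0)) t :=
    HasFDerivAt.comp_hasDerivAt (f := fun r => (r, y)) t h0
      ((hasDerivAt_id t).prodMk (hasDerivAt_const t y))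
  refine h0.congr_fderiv (ContinuousLinearMap.ext fun ⟨r, e⟩ => ?_)
  have h3 : A (r, e) = r * A (1, 0) + A (0, e) := by
    rw [← smul_eq_mul, ← map_smul, ← map_add]
    simp
  rw [h3]
  simp [h2.deriv, inner_gradient_left, h1.fderiv, mul_comm]

theorem IsLevelSetSolution.differentiableAt (h : IsLevelSetSolution v Φ₀ T D Ψ) {t : ℝ}
    (ht : t ∈ Ioo 0 T) {y : Eucl d} (hy : y ∈ interior D) :
    DifferentiableAt ℝ (fun q : ℝ × Eucl d => Ψ q.1 q.2) (t, y) :=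
  (h.contDiffOn.contDiffAt (prod_mem_nhds (Icc_mem_nhds ht.1 ht.2)
    (mem_interior_iff_mem_nhds.1 hy))).differentiableAt two_ne_zero

/-- The difference `u` of two solutions satisfies `|∂ₜu| ≤ |v| |∇u|`. -/
theorem IsLevelSetSolution.exists_hasFDerivAt_sub (h : IsLevelSetSolution v Φ₀ T D Ψ)
    (h' : IsLevelSetSolution v Φ₀ T D Ψ') {t : ℝ} (ht : t ∈ Ioo 0 T) {y : Eucl d}
    (hy : y ∈ interior D) {C : ℝ} (hC : |v y| ≤ C) :
    ∃ (b : ℝ) (g : Eucl d), HasFDerivAt (fun q : ℝ × Eucl d => Ψ q.1 q.2 - Ψ' q.1 q.2)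
      (b • ContinuousLinearMap.fst ℝ ℝ (Eucl d) +
        innerSL ℝ g ∘L ContinuousLinearMap.snd ℝ ℝ (Eucl d)) (t, y) ∧ b ≤ C * ‖g‖ := by
  have h1 := hasFDerivAt_of_differentiableAt_prod (h.differentiableAt ht hy)
  have h2 := hasFDerivAt_of_differentiableAt_prod (h'.differentiableAt ht hy)
  refine ⟨deriv (fun r => Ψ r y) t - deriv (fun r => Ψ' r y) t,
    gradient (Ψ t) y - gradient (Ψ' t) y, ?_, ?_⟩
  · refine (h1.sub h2).congr_fderiv (ContinuousLinearMap.ext fun ⟨r, e⟩ => ?_)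
    simp
    ring
  · have e1 := h.equation t ht y hy
    have e2 := h'.equation t ht y hy
    have e3 : deriv (fun r => Ψ r y) t - deriv (fun r => Ψ' r y) t =
        v y * (‖gradient (Ψ' t) y‖ - ‖gradient (Ψ t) y‖) := by linarith
    rw [e3]
    calc v y * (‖gradient (Ψ' t) y‖ - ‖gradient (Ψ t) y‖)
        ≤ |v y| * |‖gradient (Ψ' t) y‖ - ‖gradient (Ψ t) y‖| := by
          rw [← abs_mul]; exact le_abs_self _
      _ ≤ C * ‖gradient (Ψ t) y - gradient (Ψ' t) y‖ := by
          gcongr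
          · exact (abs_nonneg _).trans hC
          · rw [norm_sub_rev]; exact abs_norm_sub_norm_le _ _

/-- Local uniqueness: in the backward cone over a ball on which the equation holds, the solution is
determined by its initial value. -/
theorem IsLevelSetSolution.le_of_closedBall_subset (h : IsLevelSetSolution v Φ₀ T D Ψ)
    (h' : IsLevelSetSolution v Φ₀ T D Ψ') (hD : IsOpen D) {y : Eucl d} {δ C τ : ℝ}
    (hball : Metric.closedBall y δ ⊆ D) (hC0 : 0 ≤ C)
    (hC : ∀ x ∈ Metric.closedBall y δ, |v x| ≤ C) (hτ : τ < T) (hCτ : C * τ ≤ δ) :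
    ∀ t ∈ Icc 0 τ, Ψ t y ≤ Ψ' t y := by
  set S : Set (ℝ × Eucl d) := {a | a.1 ∈ Icc 0 τ ∧ ‖a.2 - y‖ + C * a.1 ≤ δ} with hSdef
  have hSsub : S ⊆ Icc 0 τ ×ˢ Metric.closedBall y δ := by
    rintro ⟨t, x⟩ ⟨ht, hx⟩
    refine ⟨ht, ?_⟩
    have : 0 ≤ C * t := mul_nonneg hC0 ht.1
    rw [mem_closedBall_iff_norm]
    simp only at hx
    linarith
  have hScl : IsClosed S := by
    refine (isClosed_Icc.preimage continuous_fst).inter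
      (isClosed_le (f := fun a : ℝ × Eucl d => ‖a.2 - y‖ + C * a.1) ?_ continuous_const)
    fun_prop
  have hScomp : IsCompact S :=
    (isCompact_Icc.prod (isCompact_closedBall y δ)).of_isClosed_subset hScl hSsub
  have hSD : S ⊆ Icc 0 T ×ˢ D := fun a ha =>
    ⟨⟨(hSsub ha).1.1, (hSsub ha).1.2.trans hτ.le⟩, hball (hSsub ha).2⟩
  have hmain := nonpos_of_deriv_le_mul_norm_gradient (C := C)
    (u := fun q : ℝ × Eucl d => Ψ q.1 q.2 - Ψ' q.1 q.2) hScomp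
    ((h.contDiffOn.continuousOn.mono hSD).sub (h'.contDiffOn.continuousOn.mono hSD))
    (fun a ha => (hSsub ha).1.1) (by
      rintro ⟨t, x⟩ ha
      obtain ⟨⟨ht0, htτ⟩, hx⟩ := hSsub ha
      simp only at ht0 htτ hx
      rcases ht0.eq_or_lt with rfl | ht
      · left
        simp [h.initial x (hball hx), h'.initial x (hball hx)]
      right
      obtain ⟨b, g, hd, hb⟩ := h.exists_hasFDerivAt_sub h' (t := t) (y := x)
        ⟨ht, htτ.trans_lt hτ⟩ (by rw [hD.interior_eq]; exact hball hx) (hC x hx)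
      refine ⟨b, g, hd, hb, fun e he => ?_⟩
      filter_upwards [Ioo_mem_nhdsGT ht] with s hs
      refine ⟨⟨by simp only; linarith [hs.2], by simp only; linarith [hs.1]⟩, ?_⟩
      have h1 : ‖x + s • C • e - y‖ ≤ ‖x - y‖ + s * C := by
        calc ‖x + s • C • e - y‖ = ‖(x - y) + s • C • e‖ := by congr 1; abel
          _ ≤ ‖x - y‖ + ‖s • C • e‖ := norm_add_le _ _
          _ ≤ ‖x - y‖ + s * C := by
            rw [norm_smul, norm_smul, Real.norm_of_nonneg hs.1.le, Real.norm_of_nonneg hC0]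
            gcongr
            · exact hs.1.le
            · exact mul_le_of_le_one_right hC0 he
      have h2 := ha.2
      simp only at h2 ⊢
      linarith)
  intro t ht
  have hmem : (t, y) ∈ S := by
    refine ⟨ht, ?_⟩
    simp only [sub_self, norm_zero, zero_add]
    exact (mul_le_mul_of_nonneg_left ht.2 hC0).trans hCτ
  have := hmain _ hmem
  simp only at this
  linarith

/-- Where the velocity vanishes near the boundary of the cell, a solution is constant in time. -/
theorem IsLevelSetSolution.eq_initial_of_velocity_eq_zero {U : Set (Eucl d)} (hU : IsOpen U)
    (hv : ∀ y ∈ U ∩ closure (cell d), v y = 0)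
    (h : IsLevelSetSolution v Φ₀ T (closure (cell d)) Ψ) (hΦ₀ : ContinuousOn Φ₀ (closure (cell d)))
    {t : ℝ} (ht : t ∈ Icc 0 T) {y : Eucl d} (hy : y ∈ U ∩ closure (cell d)) : Ψ t y = Φ₀ y := by
  have hint : ∀ x ∈ U ∩ cell d, Ψ t x = Φ₀ x := by
    intro x hx
    have hxc : x ∈ closure (cell d) := subset_closure hx.2
    rw [← h.initial x hxc]
    have hcont : ContinuousOn (fun r => Ψ r x) (Icc 0 T) :=
      h.contDiffOn.continuousOn.comp (f := fun r => (r, x)) (by fun_prop)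
        fun r hr => ⟨hr, hxc⟩
    have hder : ∀ r ∈ Ioo 0 T, HasDerivAt (fun r => Ψ r x) 0 r := by
      intro r hr
      have hxi : x ∈ interior (closure (cell d)) := by rw [interior_closure_cell]; exact hx.2
      have h1 := (h.differentiableAt hr hxi).hasFDerivAt.comp_hasDerivAt r
        ((hasDerivAt_id r).prodMk (hasDerivAt_const r x))
      have h2 := h.equation r hr x hxi
      rw [hv x ⟨hx.1, hxc⟩, zero_mul, add_zero] at h2
      have h3 : DifferentiableAt ℝ (fun r => Ψ r x) r := h1.differentiableAt
      rw [← h2]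
      exact h3.hasDerivAt
    rcases ht.1.eq_or_lt with rfl | ht0
    · rfl
    obtain ⟨c, hc, hce⟩ := exists_hasDerivAt_eq_slope (fun r => Ψ r x) (fun _ => 0) ht0
      (hcont.mono (Icc_subset_Icc_right ht.2)) (fun r hr => hder r ⟨hr.1, hr.2.trans_le ht.2⟩)
    rw [eq_comm, div_eq_zero_iff] at hce
    rcases hce with hce | hce
    · linarith
    · linarith
  have hcl : y ∈ closure (U ∩ cell d) := hU.inter_closure hy
  have hc1 : ContinuousOn (Ψ t) (closure (cell d)) :=
    h.contDiffOn.continuousOn.comp (f := fun x => (t, x)) (by fun_prop) fun x hx => ⟨ht, hx⟩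
  have hsub : U ∩ cell d ⊆ closure (cell d) := fun x hx => subset_closure hx.2
  have hne : (𝓝[U ∩ cell d] y).NeBot := mem_closure_iff_nhdsWithin_neBot.1 hcl
  refine tendsto_nhds_unique_of_eventuallyEq ((hc1 y hy.2).mono_left (nhdsWithin_mono _ hsub))
    ((hΦ₀ y hy.2).mono_left (nhdsWithin_mono _ hsub)) ?_
  filter_upwards [self_mem_nhdsWithin] with x hx using hint x hx

/-- One solution on the closed cell lies below another: `le_antisymm` turns this into global
uniqueness. -/
theorem IsLevelSetSolution.le_of_zero_boundary {U : Set (Eucl d)} (hU : IsOpen U)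
    (hUb : frontier (cell d) ⊆ U) (hv : ∀ y ∈ U ∩ closure (cell d), v y = 0)
    (hvc : ContinuousOn v (closure (cell d)))
    (h : IsLevelSetSolution v Φ₀ T (closure (cell d)) Ψ)
    (h' : IsLevelSetSolution v Φ₀ T (closure (cell d)) Ψ')
    (hΦ₀ : ContinuousOn Φ₀ (closure (cell d))) (hT : 0 < T) :
    ∀ t ∈ Icc 0 T, ∀ y ∈ closure (cell d), Ψ t y ≤ Ψ' t y := by
  obtain ⟨C, hC⟩ := isCompact_closure_cell.exists_bound_of_continuousOn hvc
  have hC0 : 0 ≤ C := (norm_nonneg _).trans (hC 0 (subset_closure zero_mem_cell))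
  have hlt : ∀ τ ∈ Ico 0 T, ∀ y ∈ closure (cell d), Ψ τ y ≤ Ψ' τ y := by
    intro τ hτ y hy
    have hSD : Icc 0 τ ×ˢ closure (cell d) ⊆ Icc 0 T ×ˢ closure (cell d) :=
      prod_mono (Icc_subset_Icc_right hτ.2.le) subset_rfl
    have hmain := nonpos_of_deriv_le_mul_norm_gradient (C := C)
      (u := fun q : ℝ × Eucl d => Ψ q.1 q.2 - Ψ' q.1 q.2)
      (isCompact_Icc.prod isCompact_closure_cell)
      ((h.contDiffOn.continuousOn.mono hSD).sub (h'.contDiffOn.continuousOn.mono hSD))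
      (fun a ha => ha.1.1) (by
        rintro ⟨t, x⟩ ⟨⟨ht0, htτ⟩, hx⟩
        simp only at ht0 htτ hx
        rcases ht0.eq_or_lt with rfl | ht
        · left
          simp [h.initial x hx, h'.initial x hx]
        by_cases hxU : x ∈ U
        · left
          have htT : t ∈ Icc 0 T := ⟨ht0, htτ.trans hτ.2.le⟩
          simp [h.eq_initial_of_velocity_eq_zero hU hv hΦ₀ htT ⟨hxU, hx⟩,
            h'.eq_initial_of_velocity_eq_zero hU hv hΦ₀ htT ⟨hxU, hx⟩]
        right
        have hxc := mem_cell_of_notMem hUb hx hxU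
        obtain ⟨b, g, hd, hb⟩ := h.exists_hasFDerivAt_sub h' (t := t) (y := x)
          ⟨ht, htτ.trans_lt hτ.2⟩ (by rw [interior_closure_cell]; exact hxc) (hC x hx)
        refine ⟨b, g, hd, hb, fun e he => ?_⟩
        have hcont : Tendsto (fun s : ℝ => x + s • C • e) (𝓝[>] 0) (𝓝 x) := by
          have : Continuous fun s : ℝ => x + s • C • e := by fun_prop
          simpa using (this.tendsto 0).mono_left nhdsWithin_le_nhds
        filter_upwards [Ioo_mem_nhdsGT ht, hcont (closure_cell_nhds hxc)] with s hs hs'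
        exact ⟨⟨by simp only; linarith [hs.2], by simp only; linarith [hs.1]⟩, hs'⟩)
      (τ, y) ⟨⟨hτ.1, le_rfl⟩, hy⟩
    simp only at hmain
    linarith
  intro t ht y hy
  -- the equation says nothing at the final time, which is reached by continuity
  rcases ht.2.lt_or_eq with h1 | rfl
  · exact hlt t ⟨ht.1, h1⟩ y hy
  have hc : ∀ {Ψ : ℝ → Eucl d → ℝ}, IsLevelSetSolution v Φ₀ t (closure (cell d)) Ψ →
      Tendsto (fun r => Ψ r y) (𝓝[Ico 0 t] t) (𝓝 (Ψ t y)) := by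
    intro Ψ h
    have : ContinuousOn (fun r => Ψ r y) (Icc 0 t) :=
      h.contDiffOn.continuousOn.comp (f := fun r => (r, y)) (by fun_prop) fun r hr => ⟨hr, hy⟩
    exact (this t ht).mono_left (nhdsWithin_mono _ Ico_subset_Icc_self)
  have hne : (𝓝[Ico 0 t] t).NeBot := by
    rw [← mem_closure_iff_nhdsWithin_neBot, closure_Ico hT.ne]
    exact ht
  refine le_of_tendsto_of_tendsto (hc h) (hc h') ?_
  filter_upwards [self_mem_nhdsWithin] with r hr using hlt r hr y hy

end Solutions

/-! ### Paths of functions that are jointly smooth in time and space -/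

section JointlySmooth

variable {E : Type*} [NormedAddCommGroup E] [NormedSpace ℝ E]
  {F : Type*} [NormedAddCommGroup F] [NormedSpace ℝ F] {I : Set ℝ}

theorem contDiff_slice {n : WithTop ℕ∞} {f : ℝ → E → F}
    (hf : ContDiffOn ℝ n (fun a : ℝ × E => f a.1 a.2) (I ×ˢ univ)) {t : ℝ} (ht : t ∈ I) :
    ContDiff ℝ n (f t) := by
  rw [← contDiffOn_univ]
  exact hf.comp (f := fun y => (t, y)) (contDiffOn_const.prodMk contDiffOn_id)
    fun y _ => ⟨ht, mem_univ _⟩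

theorem hasFDerivAt_slice {f : ℝ → E → F} (hI : IsOpen I)
    (hf : ContDiffOn ℝ 1 (fun a : ℝ × E => f a.1 a.2) (I ×ˢ univ)) {t : ℝ} (ht : t ∈ I) (y : E) :
    HasFDerivAt (f t) (fderiv ℝ (fun a : ℝ × E => f a.1 a.2) (t, y) ∘L .inr ℝ ℝ E) y :=
  (((hf.contDiffAt ((hI.prod isOpen_univ).mem_nhds ⟨ht, mem_univ y⟩)).differentiableAt
    one_ne_zero).hasFDerivAt).comp y (hasFDerivAt_prodMk_right t y)

theorem contDiffOn_fderiv_slice {k : ℕ} {f : ℝ → E → F} (hI : IsOpen I)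
    (hf : ContDiffOn ℝ (k + 1 : ℕ) (fun a : ℝ × E => f a.1 a.2) (I ×ˢ univ)) :
    ContDiffOn ℝ k (fun a : ℝ × E => fderiv ℝ (f a.1) a.2) (I ×ˢ univ) := by
  have h1 : ContDiffOn ℝ k (fderiv ℝ (fun a : ℝ × E => f a.1 a.2)) (I ×ˢ univ) :=
    hf.fderiv_of_isOpen (hI.prod isOpen_univ) (by norm_cast)
  refine (h1.clm_comp (contDiffOn_const (c := ContinuousLinearMap.inr ℝ ℝ E))).congr ?_
  rintro ⟨t, y⟩ ⟨ht, -⟩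
  exact (hasFDerivAt_slice hI (hf.of_le (by exact_mod_cast Nat.le_add_left 1 k)) ht y).fderiv

/-- Time and space derivative commute if the function and its time derivative are jointly `C¹`:
differentiate `f r = f 0 + ∫₀ʳ ∂ₜf` under the integral. -/
theorem hasDerivAt_fderiv_slice [FiniteDimensional ℝ E] [CompleteSpace F] {τ : ℝ}
    {f f' : ℝ → E → F}
    (hf : ContDiffOn ℝ 1 (fun a : ℝ × E => f a.1 a.2) (Ioo (-τ) τ ×ˢ univ))
    (hf' : ContDiffOn ℝ 1 (fun a : ℝ × E => f' a.1 a.2) (Ioo (-τ) τ ×ˢ univ))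
    (hd : ∀ t ∈ Ioo (-τ) τ, ∀ y, HasDerivAt (fun r => f r y) (f' t y) t)
    {t : ℝ} (ht : t ∈ Ioo (-τ) τ) (y : E) :
    HasDerivAt (fun r => fderiv ℝ (f r) y) (fderiv ℝ (f' t) y) t := by
  have h0 : (0 : ℝ) ∈ Ioo (-τ) τ := by constructor <;> linarith [ht.1, ht.2]
  have hsub : ∀ r ∈ Ioo (-τ) τ, uIcc 0 r ⊆ Ioo (-τ) τ := fun r hr =>
    ordConnected_Ioo.uIcc_subset h0 hr
  have hDc : ContinuousOn (fun a : ℝ × E => fderiv ℝ (f' a.1) a.2) (Ioo (-τ) τ ×ˢ univ) :=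
    (contDiffOn_fderiv_slice (k := 0) isOpen_Ioo (by simpa using hf')).continuousOn
  have hcy : ContinuousOn (fun s => fderiv ℝ (f' s) y) (Ioo (-τ) τ) :=
    hDc.comp (f := fun s => (s, y)) (by fun_prop) fun s hs => ⟨hs, mem_univ _⟩
  have hc' : ∀ x, ContinuousOn (fun s => f' s x) (Ioo (-τ) τ) := fun x =>
    hf'.continuousOn.comp (f := fun s => (s, x)) (by fun_prop) fun s hs => ⟨hs, mem_univ _⟩
  have hint : ∀ r ∈ Ioo (-τ) τ,
      fderiv ℝ (f r) y = fderiv ℝ (f 0) y + ∫ s in (0 : ℝ)..r, fderiv ℝ (f' s) y := by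
    intro r hr
    have hfr : ∀ x, f r x = f 0 x + ∫ s in (0 : ℝ)..r, f' s x := by
      intro x
      rw [intervalIntegral.integral_eq_sub_of_hasDerivAt (fun s hs => hd s (hsub r hr hs) x)
        ((hc' x).mono (hsub r hr)).intervalIntegrable]
      abel
    obtain ⟨C, hC⟩ := (isCompact_uIcc.prod (isCompact_closedBall y 1)).exists_bound_of_continuousOn
      (hDc.mono (prod_mono (hsub r hr) (subset_univ _)))
    have hI : HasFDerivAt (fun x => ∫ s in (0 : ℝ)..r, f' s x)
        (∫ s in (0 : ℝ)..r, fderiv ℝ (f' s) y) y := by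
      refine intervalIntegral.hasFDerivAt_integral_of_dominated_of_fderiv_le
        (F := fun x s => f' s x) (F' := fun x s => fderiv ℝ (f' s) x) (bound := fun _ => C)
        (Metric.closedBall_mem_nhds y one_pos) ?_ ?_ ?_ ?_ ?_ ?_
      · refine Eventually.of_forall fun x => ?_
        exact (((hc' x).mono (hsub r hr)).intervalIntegrable (μ := MeasureTheory.volume)
          ).def'.aestronglyMeasurable
      · exact ((hc' y).mono (hsub r hr)).intervalIntegrable
      · exact ((hcy.mono (hsub r hr)).intervalIntegrable (μ := MeasureTheory.volume)
          ).def'.aestronglyMeasurable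
      · exact Eventually.of_forall fun s hs x hx => hC (s, x) ⟨uIoc_subset_uIcc hs, hx⟩
      · exact intervalIntegrable_const
      · refine Eventually.of_forall fun s hs x _ => ?_
        exact ((contDiff_slice hf' (hsub r hr (uIoc_subset_uIcc hs))).differentiable
          one_ne_zero x).hasFDerivAt
    have h1 : HasFDerivAt (f 0) (fderiv ℝ (f 0) y) y :=
      ((contDiff_slice hf h0).differentiable one_ne_zero y).hasFDerivAt
    have h2 := h1.add hI
    have h3 : f r = f 0 + fun x => ∫ s in (0 : ℝ)..r, f' s x := funext hfr
    rw [← h3] at h2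
    exact h2.fderiv
  have hftc : HasDerivAt (fun r => ∫ s in (0 : ℝ)..r, fderiv ℝ (f' s) y) (fderiv ℝ (f' t) y) t := by
    refine intervalIntegral.integral_hasDerivAt_right
      ((hcy.mono (hsub t ht)).intervalIntegrable) ?_ (hcy.continuousAt (isOpen_Ioo.mem_nhds ht))
    exact hcy.stronglyMeasurableAtFilter isOpen_Ioo t ht
  refine (hftc.const_add (fderiv ℝ (f 0) y)).congr_of_eventuallyEq ?_
  filter_upwards [isOpen_Ioo.mem_nhds ht] with r hr using hint r hr

end JointlySmooth

/-- The derivatives in space of order `k` of a jointly `C^k` path are continuous in time, uniformly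
on compact sets. The universes of `E` and `F` agree to allow the induction on `k` that passes to the
derivative. -/
theorem eventually_norm_iteratedFDeriv_sub_le.{u} {E : Type u} [NormedAddCommGroup E]
    [NormedSpace ℝ E] {I : Set ℝ} (hI : IsOpen I) {K : Set E} (hK : IsCompact K)
    {t : ℝ} (ht : t ∈ I) (k : ℕ) :
    ∀ {F : Type u} [NormedAddCommGroup F] [NormedSpace ℝ F] {f : ℝ → E → F},
      ContDiffOn ℝ k (fun a : ℝ × E => f a.1 a.2) (I ×ˢ univ) → ∀ ε > 0, ∀ᶠ r in 𝓝 t, ∀ y ∈ K,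
        ‖iteratedFDeriv ℝ k (fun y => f r y - f t y) y‖ ≤ ε := by
  induction k with
  | zero =>
    intro F _ _ f hf ε hε
    refine hK.eventually_forall_of_forall_eventually fun y _ => ?_
    have h1 : ContinuousAt (fun a : ℝ × E => f a.1 a.2) (t, y) :=
      hf.continuousOn.continuousAt ((hI.prod isOpen_univ).mem_nhds ⟨ht, mem_univ y⟩)
    have h2 : ContinuousAt (fun a : ℝ × E => f t a.2) (t, y) :=
      (contDiff_slice hf ht).continuous.continuousAt.comp continuousAt_snd
    have h3 := (h1.sub h2).norm
    have h4 : ‖f t y - f t y‖ < ε := by simpa using hε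
    filter_upwards [h3.eventually_lt_const h4] with a ha
    rw [norm_iteratedFDeriv_zero]
    exact ha.le
  | succ k ih =>
    intro F _ _ f hf ε hε
    have hdiff : ∀ r ∈ I, Differentiable ℝ (f r) := fun r hr =>
      (contDiff_slice hf hr).differentiable (by exact_mod_cast k.succ_ne_zero)
    filter_upwards [ih (f := fun r y => fderiv ℝ (f r) y) (contDiffOn_fderiv_slice hI hf) ε hε,
      hI.mem_nhds ht] with r hr hrI y hy
    rw [← norm_iteratedFDeriv_fderiv]
    have : fderiv ℝ (fun y => f r y - f t y) = fun y => fderiv ℝ (f r) y - fderiv ℝ (f t) y :=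
      funext fun y => fderiv_fun_sub (hdiff r hrI y) (hdiff t ht y)
    rw [this]
    exact hr y hy

/-- The derivatives in space of order `k` of the difference quotients in time converge, uniformly on
compact sets, to those of the time derivative: for `k = 0` by the mean value inequality, and from
`k` to `k + 1` because time and space derivatives commute. -/
theorem eventually_norm_iteratedFDeriv_slope_sub_le.{u} {E : Type u} [NormedAddCommGroup E]
    [NormedSpace ℝ E] [FiniteDimensional ℝ E] {τ : ℝ} {K : Set E} (hK : IsCompact K) {t : ℝ}
    (ht : t ∈ Ioo (-τ) τ) (k : ℕ) :
    ∀ {F : Type u} [NormedAddCommGroup F] [NormedSpace ℝ F] [CompleteSpace F] {f f' : ℝ → E → F},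
      ContDiffOn ℝ k (fun a : ℝ × E => f a.1 a.2) (Ioo (-τ) τ ×ˢ univ) →
      ContDiffOn ℝ k (fun a : ℝ × E => f' a.1 a.2) (Ioo (-τ) τ ×ˢ univ) →
      (∀ t ∈ Ioo (-τ) τ, ∀ y, HasDerivAt (fun r => f r y) (f' t y) t) →
      ∀ ε > 0, ∀ᶠ r in 𝓝[≠] t, ∀ y ∈ K,
        ‖iteratedFDeriv ℝ k (fun y => (r - t)⁻¹ • (f r y - f t y) - f' t y) y‖ ≤ ε := by
  induction k with
  | zero =>
    intro F _ _ _ f f' hf hf' hd ε hε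
    have h1 := eventually_norm_iteratedFDeriv_sub_le isOpen_Ioo hK ht 0 hf' ε hε
    obtain ⟨δ, hδ, hb⟩ := Metric.eventually_nhds_iff_ball.1 (h1.and (isOpen_Ioo.mem_nhds ht))
    have h2 : ∀ᶠ r in 𝓝[≠] t, r ∈ Metric.ball t δ :=
      nhdsWithin_le_nhds (Metric.ball_mem_nhds t hδ)
    filter_upwards [h2, self_mem_nhdsWithin] with r hr hrt y hy
    rw [norm_iteratedFDeriv_zero]
    have h3 := (convex_ball t δ).norm_image_sub_le_of_norm_hasDerivWithin_le
      (f := fun s => f s y - s • f' t y) (f' := fun s => f' s y - f' t y) (C := ε)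
      (x := t) (y := r)
      (fun s hs => by
        refine ((hd s (hb s hs).2 y).sub ?_).hasDerivWithinAt
        simpa using (hasDerivAt_id s).smul_const (f' t y))
      (fun s hs => by simpa using (hb s hs).1 y hy) (Metric.mem_ball_self hδ) hr
    have hne : r - t ≠ 0 := sub_ne_zero.2 hrt
    have h4 : (r - t)⁻¹ • (f r y - f t y) - f' t y =
        (r - t)⁻¹ • ((f r y - r • f' t y) - (f t y - t • f' t y)) := by
      have : (f r y - r • f' t y) - (f t y - t • f' t y) =
          (f r y - f t y) - (r - t) • f' t y := by
        rw [sub_smul]; abel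
      rw [this, smul_sub _ (f r y - f t y), smul_smul, inv_mul_cancel₀ hne, one_smul]
    rw [h4, norm_smul, norm_inv, inv_mul_le_iff₀ (norm_pos_iff.2 hne), mul_comm]
    exact h3
  | succ k ih =>
    intro F _ _ _ f f' hf hf' hd ε hε
    have hk : ((k + 1 : ℕ) : WithTop ℕ∞) ≠ 0 := by exact_mod_cast k.succ_ne_zero
    have h1k : (1 : WithTop ℕ∞) ≤ (k + 1 : ℕ) := by exact_mod_cast Nat.le_add_left 1 k
    have hdiff : ∀ r ∈ Ioo (-τ) τ, Differentiable ℝ (f r) := fun r hr =>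
      (contDiff_slice hf hr).differentiable hk
    have hdiff' : Differentiable ℝ (f' t) := (contDiff_slice hf' ht).differentiable hk
    filter_upwards [ih (contDiffOn_fderiv_slice isOpen_Ioo hf)
      (contDiffOn_fderiv_slice isOpen_Ioo hf')
      (fun s hs y => hasDerivAt_fderiv_slice (hf.of_le h1k) (hf'.of_le h1k) hd hs y) ε hε,
      nhdsWithin_le_nhds (isOpen_Ioo.mem_nhds ht)] with r hr hrI y hy
    rw [← norm_iteratedFDeriv_fderiv]
    have : fderiv ℝ (fun y => (r - t)⁻¹ • (f r y - f t y) - f' t y) =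
        fun y => (r - t)⁻¹ • (fderiv ℝ (f r) y - fderiv ℝ (f t) y) - fderiv ℝ (f' t) y :=
      funext fun y => (((((hdiff r hrI y).hasFDerivAt.sub (hdiff t ht y).hasFDerivAt).const_smul
        (r - t)⁻¹).sub (hdiff' y).hasFDerivAt).fderiv)
    rw [this]
    exact hr y hy

section HoelderNorm

variable {E : Type*} [NormedAddCommGroup E] [NormedSpace ℝ E]
  {F : Type*} [NormedAddCommGroup F] [NormedSpace ℝ F] {s : Set E} {k : ℕ} {g : E → F}

theorem lipschitzOnWith_iteratedFDerivWithin (hs : Convex ℝ s) (hu : UniqueDiffOn ℝ s)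
    (hg : ContDiff ℝ (k + 1 : ℕ) g) {C : ℝ≥0}
    (hC : ∀ y ∈ s, ‖iteratedFDeriv ℝ (k + 1) g y‖ ≤ C) :
    LipschitzOnWith C (iteratedFDerivWithin ℝ k g s) s := by
  have h1 : LipschitzOnWith C (iteratedFDeriv ℝ k g) s := by
    refine hs.lipschitzOnWith_of_nnnorm_fderiv_le (𝕜 := ℝ) (fun y _ => ?_) fun y hy => ?_
    · exact hg.differentiable_iteratedFDeriv (by exact_mod_cast Nat.lt_succ_self k) y
    · rw [← NNReal.coe_le_coe, coe_nnnorm, norm_fderiv_iteratedFDeriv]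
      exact hC y hy
  have hk : ContDiff ℝ k g := hg.of_le (by exact_mod_cast Nat.le_succ k)
  intro x hx y hy
  rw [iteratedFDerivWithin_eq_iteratedFDeriv hu hk.contDiffAt hx,
    iteratedFDerivWithin_eq_iteratedFDeriv hu hk.contDiffAt hy]
  exact h1 hx hy

theorem isHoelderClass_of_contDiff (hs : Convex ℝ s) (hu : UniqueDiffOn ℝ s) (hc : IsCompact s)
    (hg : ContDiff ℝ (k + 1 : ℕ) g) : IsHoelderClass k 1 s g := by
  refine ⟨(hg.of_le (by exact_mod_cast Nat.le_succ k)).contDiffOn, ?_⟩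
  obtain ⟨C, hC⟩ := hc.exists_bound_of_continuousOn
    (hg.continuous_iteratedFDeriv (m := k + 1) (by exact_mod_cast le_rfl)).continuousOn
  refine ⟨C.toNNReal, holderOnWith_one.2 (lipschitzOnWith_iteratedFDerivWithin hs hu hg ?_)⟩
  exact fun y hy => (hC y hy).trans (Real.le_coe_toNNReal C)

/-- The `C^{k,1}` norm on a convex set is controlled by the derivatives of order up to `k + 1`. -/
theorem hoelderENorm_le_of_contDiff (hs : Convex ℝ s) (hu : UniqueDiffOn ℝ s)
    (hg : ContDiff ℝ (k + 1 : ℕ) g) {ε : ℝ}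
    (hb : ∀ j ≤ k + 1, ∀ y ∈ s, ‖iteratedFDeriv ℝ j g y‖ ≤ ε) :
    hoelderENorm k 1 s g ≤ ENNReal.ofReal ε + ENNReal.ofReal ε := by
  refine add_le_add ?_ ?_
  · refine iSup₂_le fun j hj => iSup₂_le fun x hx => ?_
    have hjk : ContDiff ℝ j g := hg.of_le (by exact_mod_cast hj.trans (Nat.le_succ k))
    rw [iteratedFDerivWithin_eq_iteratedFDeriv hu hjk.contDiffAt hx, ← ofReal_norm]
    exact ENNReal.ofReal_le_ofReal (hb j (hj.trans (Nat.le_succ k)) x hx)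
  · refine iSup₂_le fun x hx => iSup₂_le fun y hy => ?_
    have hl := lipschitzOnWith_iteratedFDerivWithin (C := ε.toNNReal) hs hu hg
      (fun y hy => (hb _ le_rfl y hy).trans (Real.le_coe_toNNReal ε))
    rw [NNReal.coe_one, ENNReal.rpow_one]
    exact ENNReal.div_le_of_le_mul (hl hx hy)

end HoelderNorm

/-- A path of functions is `C¹` in `C^{k,1}` if the functions and their time derivatives are jointly
`C^{k+1}` in time and space. -/
theorem isC1Path_of_contDiffOn.{u} {E F : Type u} [NormedAddCommGroup E] [NormedSpace ℝ E]
    [NormedAddCommGroup F] [NormedSpace ℝ F] {s : Set E} {k : ℕ}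
    [FiniteDimensional ℝ E] [CompleteSpace F] {τ T : ℝ} (hT : T < τ)
    (hs : Convex ℝ s) (hu : UniqueDiffOn ℝ s) (hc : IsCompact s) {f f' : ℝ → E → F}
    (hf : ContDiffOn ℝ (k + 1 : ℕ) (fun a : ℝ × E => f a.1 a.2) (Ioo (-τ) τ ×ˢ univ))
    (hf' : ContDiffOn ℝ (k + 1 : ℕ) (fun a : ℝ × E => f' a.1 a.2) (Ioo (-τ) τ ×ˢ univ))
    (hd : ∀ t ∈ Ioo (-τ) τ, ∀ y, HasDerivAt (fun r => f r y) (f' t y) t) :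
    IsC1Path k 1 s T f := by
  have hsub : Icc 0 T ⊆ Ioo (-τ) τ := fun t ht =>
    ⟨by linarith [ht.1, ht.2], ht.2.trans_lt hT⟩
  have hlim : ∀ {l : Filter ℝ} {φ : ℝ → ℝ≥0∞},
      (∀ ε > 0, ∀ᶠ r in l, φ r ≤ ENNReal.ofReal ε + ENNReal.ofReal ε) → Tendsto φ l (𝓝 0) := by
    intro l φ h
    rw [ENNReal.tendsto_nhds_zero]
    intro e he
    rcases eq_or_ne e ⊤ with rfl | hetop
    · exact Eventually.of_forall fun _ => le_top
    have h2 := h (e.toReal / 2) (half_pos (ENNReal.toReal_pos he.ne' hetop))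
    rw [← ENNReal.ofReal_add (by positivity) (by positivity), add_halves,
      ENNReal.ofReal_toReal hetop] at h2
    exact h2
  refine ⟨fun t ht => isHoelderClass_of_contDiff hs hu hc (contDiff_slice hf (hsub ht)), f',
    fun t ht => isHoelderClass_of_contDiff hs hu hc (contDiff_slice hf' (hsub ht)),
    fun t ht => hlim fun ε hε => ?_, fun t ht => hlim fun ε hε => ?_⟩
  · have h1 : ∀ᶠ r in 𝓝[≠] t, ∀ j ∈ Finset.range (k + 2), ∀ y ∈ s,
        ‖iteratedFDeriv ℝ j (fun y => (r - t)⁻¹ • (f r y - f t y) - f' t y) y‖ ≤ ε := by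
      rw [eventually_all_finset]
      intro j hj
      have hj' : (j : WithTop ℕ∞) ≤ (k + 1 : ℕ) := by
        exact_mod_cast Nat.lt_succ_iff.1 (Finset.mem_range.1 hj)
      exact eventually_norm_iteratedFDeriv_slope_sub_le hc (hsub ht) j (hf.of_le hj')
        (hf'.of_le hj') hd ε hε
    have h2 : 𝓝[Icc 0 T \ {t}] t ≤ 𝓝[≠] t := nhdsWithin_mono _ fun r hr => hr.2
    filter_upwards [h2 h1, self_mem_nhdsWithin] with r hr hrI
    refine hoelderENorm_le_of_contDiff hs hu ?_
      fun j hj => hr j (Finset.mem_range.2 (Nat.lt_succ_iff.2 hj))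
    exact (((contDiff_slice hf (hsub hrI.1)).sub (contDiff_slice hf (hsub ht))).const_smul
      (r - t)⁻¹).sub (contDiff_slice hf' (hsub ht))
  · have h1 : ∀ᶠ r in 𝓝 t, ∀ j ∈ Finset.range (k + 2), ∀ y ∈ s,
        ‖iteratedFDeriv ℝ j (fun y => f' r y - f' t y) y‖ ≤ ε := by
      rw [eventually_all_finset]
      intro j hj
      have hj' : (j : WithTop ℕ∞) ≤ (k + 1 : ℕ) := by
        exact_mod_cast Nat.lt_succ_iff.1 (Finset.mem_range.1 hj)
      exact eventually_norm_iteratedFDeriv_sub_le isOpen_Ioo hc (hsub ht) j (hf'.of_le hj') ε hε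
    filter_upwards [nhdsWithin_le_nhds h1, self_mem_nhdsWithin] with r hr hrI
    refine hoelderENorm_le_of_contDiff hs hu ?_
      fun j hj => hr j (Finset.mem_range.2 (Nat.lt_succ_iff.2 hj))
    exact (contDiff_slice hf' (hsub hrI)).sub (contDiff_slice hf' (hsub ht))

/-! ### Products of functions of class `C^{k,1}` and the localization of the velocity -/

section HoelderProduct

variable {E : Type*} [NormedAddCommGroup E] [NormedSpace ℝ E]
  {F : Type*} [NormedAddCommGroup F] [NormedSpace ℝ F] {s : Set E} {k : ℕ}

theorem isHoelderClass_zero_iff {f : E → F} :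
    IsHoelderClass 0 1 s f ↔ ∃ C : ℝ≥0, LipschitzOnWith C f s := by
  have key : ∀ C : ℝ≥0, LipschitzOnWith C (iteratedFDerivWithin ℝ 0 f s) s ↔
      LipschitzOnWith C f s := by
    intro C
    rw [iteratedFDerivWithin_zero_eq_comp]
    simp only [LipschitzOnWith, Function.comp, LinearIsometryEquiv.edist_map]
  constructor
  · rintro ⟨-, C, hC⟩
    exact ⟨C, (key C).1 (holderOnWith_one.1 hC)⟩
  · rintro ⟨C, hC⟩
    exact ⟨by simpa [contDiffOn_zero] using hC.continuousOn, C, holderOnWith_one.2 ((key C).2 hC)⟩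

theorem isHoelderClass_succ_iff {f : E → F} (hu : UniqueDiffOn ℝ s) :
    IsHoelderClass (k + 1) 1 s f ↔
      DifferentiableOn ℝ f s ∧ IsHoelderClass k 1 s (fderivWithin ℝ f s) := by
  have key : ∀ C : ℝ≥0, LipschitzOnWith C (iteratedFDerivWithin ℝ (k + 1) f s) s ↔
      LipschitzOnWith C (iteratedFDerivWithin ℝ k (fderivWithin ℝ f s) s) s := by
    intro C
    have h1 : EqOn (iteratedFDerivWithin ℝ (k + 1) f s)
        ((continuousMultilinearCurryRightEquiv' ℝ k E F).symm ∘
          iteratedFDerivWithin ℝ k (fderivWithin ℝ f s) s) s :=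
      fun x hx => iteratedFDerivWithin_succ_eq_comp_right hu hx
    refine forall₂_congr fun x hx => forall₂_congr fun y hy => ?_
    rw [h1 hx, h1 hy, Function.comp, Function.comp, LinearIsometryEquiv.edist_map]
  unfold IsHoelderClass
  simp only [holderOnWith_one, key]
  rw [Nat.cast_succ, contDiffOn_succ_iff_fderivWithin hu]
  simp [and_assoc]

theorem IsHoelderClass.of_succ {f : E → F} (hs : Convex ℝ s) (hu : UniqueDiffOn ℝ s)
    (hc : IsCompact s) (hf : IsHoelderClass (k + 1) 1 s f) : IsHoelderClass k 1 s f := by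
  have hf' : ContDiffOn ℝ (k + 1 : ℕ) f s := hf.1
  refine ⟨hf'.of_le (by exact_mod_cast Nat.le_succ k), ?_⟩
  obtain ⟨C, hC⟩ := hc.exists_bound_of_continuousOn
    (hf'.continuousOn_iteratedFDerivWithin (m := k + 1) le_rfl hu)
  refine ⟨C.toNNReal, holderOnWith_one.2 ?_⟩
  refine hs.lipschitzOnWith_of_nnnorm_fderivWithin_le (𝕜 := ℝ)
    (hf'.differentiableOn_iteratedFDerivWithin (by exact_mod_cast Nat.lt_succ_self k) hu)
    fun y hy => ?_
  rw [← NNReal.coe_le_coe, coe_nnnorm, norm_fderivWithin_iteratedFDerivWithin]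
  exact (hC y hy).trans (Real.le_coe_toNNReal C)

theorem IsHoelderClass.add {f g : E → F} (hu : UniqueDiffOn ℝ s) (hf : IsHoelderClass k 1 s f)
    (hg : IsHoelderClass k 1 s g) : IsHoelderClass k 1 s (fun y => f y + g y) := by
  obtain ⟨hf, C, hC⟩ := hf
  obtain ⟨hg, C', hC'⟩ := hg
  refine ⟨hf.add hg, C + C', holderOnWith_one.2 ?_⟩
  rw [holderOnWith_one] at hC hC'
  intro x hx y hy
  change edist (iteratedFDerivWithin ℝ k (f + g) s x) (iteratedFDerivWithin ℝ k (f + g) s y) ≤ _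
  rw [iteratedFDerivWithin_add_apply (hf x hx) (hg x hx) hu hx,
    iteratedFDerivWithin_add_apply (hf y hy) (hg y hy) hu hy]
  refine (edist_add_add_le _ _ _ _).trans ?_
  rw [ENNReal.coe_add, add_mul]
  exact add_le_add (hC hx hy) (hC' hx hy)

theorem IsHoelderClass.congr {f g : E → F} (hf : IsHoelderClass k 1 s f) (h : EqOn g f s) :
    IsHoelderClass k 1 s g := by
  obtain ⟨h1, C, hC⟩ := hf
  refine ⟨h1.congr h, C, holderOnWith_one.2 fun x hx y hy => ?_⟩
  rw [iteratedFDerivWithin_congr h hx, iteratedFDerivWithin_congr h hy]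
  exact holderOnWith_one.1 hC hx hy

end HoelderProduct

/-- The class `C^{k,1}` on a compact convex set is stable under bounded bilinear maps, by induction
on `k` through the product rule. -/
theorem IsHoelderClass.bilinear.{u} {E : Type u} [NormedAddCommGroup E] [NormedSpace ℝ E]
    {s : Set E} (hs : Convex ℝ s) (hu : UniqueDiffOn ℝ s) (hc : IsCompact s) (k : ℕ) :
    ∀ {F G H : Type u} [NormedAddCommGroup F] [NormedSpace ℝ F] [NormedAddCommGroup G]
      [NormedSpace ℝ G] [NormedAddCommGroup H] [NormedSpace ℝ H] (B : F →L[ℝ] G →L[ℝ] H)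
      {f : E → F} {g : E → G}, IsHoelderClass k 1 s f → IsHoelderClass k 1 s g →
      IsHoelderClass k 1 s (fun y => B (f y) (g y)) := by
  induction k with
  | zero =>
    intro F G H _ _ _ _ _ _ B f g hf hg
    obtain ⟨M, hM⟩ := hc.exists_bound_of_continuousOn hf.1.continuousOn
    obtain ⟨M', hM'⟩ := hc.exists_bound_of_continuousOn hg.1.continuousOn
    rw [isHoelderClass_zero_iff] at hf hg ⊢
    obtain ⟨C, hC⟩ := hf
    obtain ⟨C', hC'⟩ := hg
    refine ⟨‖B‖₊ * (C * M'.toNNReal + M.toNNReal * C'), LipschitzOnWith.of_dist_le_mul ?_⟩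
    intro x hx y hy
    have h1 := hC.dist_le_mul x hx y hy
    have h2 := hC'.dist_le_mul x hx y hy
    rw [dist_eq_norm] at h1 h2 ⊢
    have h3 : B (f x) (g x) - B (f y) (g y) = B (f x - f y) (g x) + B (f y) (g x - g y) := by
      simp
    rw [h3]
    have h4 : ‖g x‖ ≤ M'.toNNReal := (hM' x hx).trans (Real.le_coe_toNNReal _)
    have h5 : ‖f y‖ ≤ M.toNNReal := (hM y hy).trans (Real.le_coe_toNNReal _)
    calc ‖B (f x - f y) (g x) + B (f y) (g x - g y)‖
        ≤ ‖B‖ * ‖f x - f y‖ * ‖g x‖ + ‖B‖ * ‖f y‖ * ‖g x - g y‖ :=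
          (norm_add_le _ _).trans (add_le_add (B.le_opNorm₂ _ _) (B.le_opNorm₂ _ _))
      _ ≤ ‖B‖ * (C * dist x y) * M'.toNNReal + ‖B‖ * M.toNNReal * (C' * dist x y) := by gcongr
      _ = (‖B‖₊ * (C * M'.toNNReal + M.toNNReal * C') : ℝ≥0) * dist x y := by
          push_cast
          ring
  | succ k ih =>
    intro F G H _ _ _ _ _ _ B f g hf hg
    have hf0 := hf.of_succ hs hu hc
    have hg0 := hg.of_succ hs hu hc
    rw [isHoelderClass_succ_iff hu] at hf hg ⊢
    refine ⟨fun y hy => (B.hasFDerivWithinAt_of_bilinear (hf.1 y hy).hasFDerivWithinAt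
      (hg.1 y hy).hasFDerivWithinAt).differentiableWithinAt, ?_⟩
    refine ((ih (B.precompR E) hf0 hg.2).add hu (ih (B.precompL E) hf.2 hg0)).congr fun y hy => ?_
    exact B.fderivWithin_of_bilinear (hf.1 y hy) (hg.1 y hy) (hu y hy)

/-- A smooth function that equals `1` near one closed set and `0` near another one. -/
theorem exists_contDiff_one_nhds_zero_nhds {E : Type*} [NormedAddCommGroup E] [NormedSpace ℝ E]
    [FiniteDimensional ℝ E] {s t : Set E} (hs : IsClosed s) (ht : IsClosed t) (h : Disjoint s t) :
    ∃ χ : E → ℝ, ContDiff ℝ (⊤ : ℕ∞) χ ∧ (∀ᶠ x in 𝓝ˢ s, χ x = 1) ∧ (∀ᶠ x in 𝓝ˢ t, χ x = 0) := by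
  obtain ⟨χ, h0, h1, -⟩ := exists_contMDiffMap_zero_one_nhds_of_isClosed
    (modelWithCornersSelf ℝ E) (n := ⊤) ht hs h.symm
  exact ⟨χ, χ.contMDiff.contDiff, h1, h0⟩

section Interface

variable {d : ℕ} {v Φ₀ : Eucl d → ℝ} {Γ U : Set (Eucl d)}

theorem continuousOn_gradientWithin {n : WithTop ℕ∞} (hn : n ≠ 0)
    (h : ContDiffOn ℝ n Φ₀ (closure (cell d))) :
    ContinuousOn (gradientWithin Φ₀ (closure (cell d))) (closure (cell d)) :=
  (InnerProductSpace.toDual ℝ (Eucl d)).symm.continuous.comp_continuousOn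
    (h.continuousOn_fderivWithin uniqueDiffOn_closure_cell (ENat.one_le_iff_ne_zero_withTop.2 hn))

theorem gradientWithin_closure_cell {f : Eucl d → ℝ} {y : Eucl d} (hy : y ∈ cell d) :
    gradientWithin f (closure (cell d)) y = gradient f y := by
  rw [gradientWithin, gradient, fderivWithin_of_mem_nhds (closure_cell_nhds hy)]

theorem IsRegularLevelSetFunction.isCompact {k : ℕ} {α : ℝ≥0}
    (h : IsRegularLevelSetFunction k α Γ Φ₀) : IsCompact Γ := by
  obtain ⟨-, O, -, hc, -, hΓ, -⟩ := h
  rw [hΓ]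
  exact hc.of_isClosed_subset isClosed_frontier frontier_subset_closure

theorem IsRegularLevelSetFunction.eq_zeroSet {k : ℕ} {α : ℝ≥0}
    (h : IsRegularLevelSetFunction k α Γ Φ₀) : Γ = {y ∈ cell d | Φ₀ y = 0} := by
  obtain ⟨-, O, -, -, -, -, h, -⟩ := h
  exact h

theorem IsRegularLevelSetFunction.gradient_ne_zero {k : ℕ} {α : ℝ≥0}
    (h : IsRegularLevelSetFunction k α Γ Φ₀) {y : Eucl d} (hy : y ∈ Γ) : gradient Φ₀ y ≠ 0 := by
  obtain ⟨-, O, -, -, -, -, -, hν⟩ := h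
  obtain ⟨-, V, hV, ρ, hρ, heq⟩ := hν y hy
  intro h0
  have hne := hρ.gradient_ne y hV
  rw [h0, neg_zero, eq_comm, smul_eq_zero, inv_eq_zero, norm_eq_zero] at heq
  exact hne (heq.elim id id)

/-- The set of critical points of the initial level-set function in the closed cell. -/
def criticalSet (Φ₀ : Eucl d → ℝ) : Set (Eucl d) :=
  {y ∈ closure (cell d) | gradientWithin Φ₀ (closure (cell d)) y = 0}

theorem isClosed_criticalSet {n : WithTop ℕ∞} (hn : n ≠ 0)
    (h : ContDiffOn ℝ n Φ₀ (closure (cell d))) : IsClosed (criticalSet Φ₀) :=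
  (continuousOn_gradientWithin hn h).preimage_isClosed_of_isClosed isClosed_closure
    isClosed_singleton

/-- The interface is compact and disjoint from the closed sets `closure U` and of critical points,
so that a smooth cut-off function is `1` near the interface and `0` near both of them. -/
theorem exists_isLocalizedVelocity (hv : IsHoelderClass 4 1 (closure (cell d)) v)
    (hΦ₀ : ContDiffOn ℝ 4 Φ₀ (closure (cell d))) (hreg : IsRegularLevelSetFunction 4 0 Γ Φ₀)
    (hUΓ : Disjoint (closure U) Γ) :
    ∃ (N : Set (Eucl d)) (w : Eucl d → ℝ), IsLocalizedVelocity v Φ₀ Γ U N w := by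
  have hΓ : Γ ⊆ cell d := by
    rw [hreg.eq_zeroSet]
    exact fun y hy => hy.1
  have hcl : IsClosed (criticalSet Φ₀) := isClosed_criticalSet four_ne_zero hΦ₀
  have hdisj : Disjoint Γ (closure U ∪ criticalSet Φ₀) := by
    refine disjoint_union_right.2 ⟨hUΓ.symm, disjoint_left.2 fun y hy hy' => ?_⟩
    have := hy'.2
    rw [gradientWithin_closure_cell (hΓ hy)] at this
    exact hreg.gradient_ne_zero hy this
  obtain ⟨χ, hχ, h1, h0⟩ := exists_contDiff_one_nhds_zero_nhds hreg.isCompact.isClosed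
    (isClosed_closure.union hcl) hdisj
  obtain ⟨N, hN, hΓN, hN1⟩ := eventually_nhdsSet_iff_exists.1 h1
  obtain ⟨W, hW, hZW, hW0⟩ := eventually_nhdsSet_iff_exists.1 h0
  have hχ5 : ContDiff ℝ (4 + 1 : ℕ) χ := contDiff_infty.1 hχ _
  refine ⟨N ∩ cell d, fun y => χ y * v y, ?_, hN.inter isOpen_cell, subset_inter hΓN hΓ,
    inter_subset_right, fun y hy => ?_, fun y hy => ?_, W, hW, ?_, fun y hy => ?_⟩
  · exact IsHoelderClass.bilinear convex_closure_cell uniqueDiffOn_closure_cell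
      isCompact_closure_cell 4 (ContinuousLinearMap.mul ℝ ℝ)
      (isHoelderClass_of_contDiff convex_closure_cell uniqueDiffOn_closure_cell
        isCompact_closure_cell hχ5) hv
  · rw [hN1 y hy.1, one_mul]
  · rw [hW0 y (hZW (Or.inl (subset_closure hy.1))), zero_mul]
  · exact subset_union_right.trans hZW
  · rw [hW0 y hy.1, zero_mul]

end Interface

/-! ### Inversion of a path of near-identity maps -/

section Inversion

theorem bijective_of_norm_fderiv_sub_id_le {E : Type*} [NormedAddCommGroup E] [NormedSpace ℝ E]
    [CompleteSpace E] {f : E → E} (hf : Differentiable ℝ f)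
    (h : ∀ y, ‖fderiv ℝ f y - .id ℝ E‖ ≤ 1 / 2) : Function.Bijective f := by
  have h1 : ApproximatesLinearOn f ((ContinuousLinearEquiv.refl ℝ E : E ≃L[ℝ] E) : E →L[ℝ] E) univ
      (1 / 2 : ℝ≥0) := by
    intro x _ y _
    have := convex_univ.norm_image_sub_le_of_norm_hasFDerivWithin_le' (f := f) (f' := fderiv ℝ f)
      (φ := .id ℝ E) (fun z _ => (hf z).hasFDerivAt.hasFDerivWithinAt) (fun z _ => h z)
      (mem_univ y) (mem_univ x)
    simpa using this
  have h2 : Subsingleton E ∨ (1 / 2 : ℝ≥0) <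
      ‖((ContinuousLinearEquiv.refl ℝ E).symm : E →L[ℝ] E)‖₊⁻¹ := by
    rcases subsingleton_or_nontrivial E with hE | hE
    · exact Or.inl hE
    · refine Or.inr ?_
      have h3 : ‖((ContinuousLinearEquiv.refl ℝ E).symm : E →L[ℝ] E)‖₊ = 1 :=
        ContinuousLinearMap.nnnorm_id
      rw [h3, inv_one]
      exact NNReal.half_lt_self one_ne_zero
  exact (h1.toHomeomorph f h2).bijective

/-- A path of maps whose spatial derivatives are close to the identity consists of bijections, and
the inverse path is jointly as smooth as the path. -/
theorem exists_contDiffOn_inverse {E : Type*} [NormedAddCommGroup E] [NormedSpace ℝ E]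
    [CompleteSpace E] {n : WithTop ℕ∞} (hn : n ≠ 0) {I : Set ℝ} (hI : IsOpen I) {h : ℝ → E → E}
    (hh : ContDiffOn ℝ n (fun a : ℝ × E => h a.1 a.2) (I ×ˢ univ))
    (hsmall : ∀ t ∈ I, ∀ y, ‖fderiv ℝ (h t) y - .id ℝ E‖ ≤ 1 / 2) :
    ∃ g : ℝ → E → E, (∀ t ∈ I, ∀ y, g t (h t y) = y) ∧ (∀ t ∈ I, ∀ x, h t (g t x) = x) ∧
      ContDiffOn ℝ n (fun a : ℝ × E => g a.1 a.2) (I ×ˢ univ) := by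
  have hdiff : ∀ t ∈ I, Differentiable ℝ (h t) := fun t ht =>
    (contDiff_slice hh ht).differentiable hn
  have hbij : ∀ t ∈ I, Function.Bijective (h t) := fun t ht =>
    bijective_of_norm_fderiv_sub_id_le (hdiff t ht) (hsmall t ht)
  set g : ℝ → E → E := fun t => Function.invFun (h t)
  have hgh : ∀ t ∈ I, ∀ y, g t (h t y) = y := fun t ht =>
    Function.leftInverse_invFun (hbij t ht).1
  have hhg : ∀ t ∈ I, ∀ x, h t (g t x) = x := fun t ht =>
    Function.rightInverse_invFun (hbij t ht).2
  refine ⟨g, hgh, hhg, ?_⟩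
  rintro ⟨t, x⟩ ⟨ht, -⟩
  refine ContDiffAt.contDiffWithinAt ?_
  set G : (ℝ × E) × E → E := fun a => h a.1.1 a.2 - a.1.2
  have hG : ContDiffAt ℝ n G ((t, x), g t x) := by
    have h1 : ContDiffAt ℝ n (fun a : (ℝ × E) × E => h a.1.1 a.2) ((t, x), g t x) :=
      (hh.contDiffAt ((hI.prod isOpen_univ).mem_nhds
        (show (t, g t x) ∈ I ×ˢ univ from ⟨ht, mem_univ _⟩))).comp
        (f := fun a : (ℝ × E) × E => (a.1.1, a.2)) ((t, x), g t x)
        (contDiffAt_fst.fst.prodMk contDiffAt_snd)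
    exact h1.sub contDiffAt_fst.snd
  have hval : G ((t, x), g t x) = 0 := by
    simp only [G, hhg t ht, sub_self]
  refine contDiffAt_of_unique_implicit (G := G) (s := fun a : ℝ × E => g a.1 a.2) hn hG ?_ ?_
  · have h1 := (hG.differentiableAt hn).hasFDerivAt.comp (g t x)
      (hasFDerivAt_prodMk_right (t, x) (g t x))
    have h2 : HasFDerivAt (fun y => h t y - x) (fderiv ℝ (h t) (g t x)) (g t x) :=
      (hdiff t ht (g t x)).hasFDerivAt.sub_const x
    rw [h1.unique h2]
    have h3 := isInvertible_id_sub (t := .id ℝ E - fderiv ℝ (h t) (g t x)) (by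
      rw [norm_sub_rev]
      exact (hsmall t ht _).trans_lt (by norm_num))
    rwa [sub_sub_cancel] at h3
  · filter_upwards [(hI.prod isOpen_univ).mem_nhds
      (show (t, x) ∈ I ×ˢ (univ : Set E) from ⟨ht, mem_univ _⟩)] with a ha b hb
    have h1 : h a.1 b = a.2 := by
      rw [hval] at hb
      exact sub_eq_zero.1 hb
    rw [← h1, hgh a.1 ha.1]

end Inversion

/-! ### Regularized norms and gradients -/

section NormCutoff

variable {E : Type*} [NormedAddCommGroup E] [InnerProductSpace ℝ E]

/-- The norm coincides on an annulus with a smooth compactly supported function. -/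
theorem exists_normCutoff [FiniteDimensional ℝ E] {c C : ℝ} (hc : 0 < c) :
    ∃ ρ : E → ℝ, ContDiff ℝ (⊤ : ℕ∞) ρ ∧ HasCompactSupport ρ ∧
      ∀ p, c < ‖p‖ → ‖p‖ < C → ρ p = ‖p‖ := by
  obtain ⟨χ, hχ, h1, h0⟩ := exists_contDiff_one_nhds_zero_nhds
    (s := {p : E | c ≤ ‖p‖ ∧ ‖p‖ ≤ C}) (t := {p : E | ‖p‖ ≤ c / 2} ∪ {p : E | C + 1 ≤ ‖p‖})
    ((isClosed_le continuous_const continuous_norm).inter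
      (isClosed_le continuous_norm continuous_const))
    ((isClosed_le continuous_norm continuous_const).union
      (isClosed_le continuous_const continuous_norm))
    (disjoint_left.2 fun p hp hp' => by
      rcases hp' with h | h
      · linarith [hp.1, (show ‖p‖ ≤ c / 2 from h)]
      · linarith [hp.2, (show C + 1 ≤ ‖p‖ from h)])
  refine ⟨fun p => χ p * ‖p‖, ?_, ?_, fun p hp hp' => ?_⟩
  · rw [contDiff_iff_contDiffAt]
    intro p
    rcases eq_or_ne p 0 with rfl | hp
    · have h00 : (0 : E) ∈ {p : E | ‖p‖ ≤ c / 2} ∪ {p : E | C + 1 ≤ ‖p‖} := by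
        refine mem_union_left _ ?_
        change ‖(0 : E)‖ ≤ c / 2
        rw [norm_zero]
        exact (half_pos hc).le
      have h2 : ∀ᶠ x in 𝓝 (0 : E), χ x = 0 := h0.filter_mono (nhds_le_nhdsSet h00)
      refine (contDiffAt_const (c := (0 : ℝ))).congr_of_eventuallyEq ?_
      filter_upwards [h2] with x hx
      rw [hx, zero_mul]
    · exact hχ.contDiffAt.mul (contDiffAt_norm ℝ hp)
  · refine HasCompactSupport.intro (isCompact_closedBall (0 : E) (C + 1)) fun p hp => ?_
    have h2 : χ p = 0 := h0.self_of_nhdsSet p (Or.inr (by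
      rw [mem_closedBall_zero_iff, not_le] at hp
      exact hp.le))
    rw [h2, zero_mul]
  · have h2 : χ p = 1 := h1.self_of_nhdsSet p ⟨hp.le, hp'.le⟩
    simp only [h2, one_mul]

theorem hasGradientAt_norm [CompleteSpace E] {p : E} (hp : p ≠ 0) :
    HasGradientAt (fun x : E => ‖x‖) (‖p‖⁻¹ • p) p := by
  have h1 : HasFDerivAt (fun x : E => ‖x‖ ^ 2) (2 • innerSL ℝ p) p :=
    (hasStrictFDerivAt_norm_sq p).hasFDerivAt
  have h2 := h1.sqrt (by positivity)
  have h3 : (fun x : E => √(‖x‖ ^ 2)) = fun x => ‖x‖ :=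
    funext fun x => Real.sqrt_sq (norm_nonneg x)
  rw [h3] at h2
  rw [hasGradientAt_iff_hasFDerivAt]
  refine h2.congr_fderiv (ContinuousLinearMap.ext fun x => ?_)
  rw [Real.sqrt_sq (norm_nonneg p)]
  have : ‖p‖ ≠ 0 := norm_ne_zero_iff.2 hp
  simp
  field_simp

theorem contDiff_gradient [CompleteSpace E] {n m : WithTop ℕ∞} {f : E → ℝ} (hf : ContDiff ℝ n f)
    (hm : m + 1 ≤ n) : ContDiff ℝ m (gradient f) :=
  (InnerProductSpace.toDual ℝ E).symm.contDiff.comp (hf.fderiv_right hm)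

theorem gradient_eq_zero_of_notMem_tsupport [CompleteSpace E] {f : E → ℝ} {x : E}
    (hx : x ∉ tsupport f) : gradient f x = 0 := by
  rw [gradient, fderiv_of_notMem_tsupport ℝ hx, map_zero]

end NormCutoff

/-! ### The Hamiltonian flow of `w(x)|p|` -/

section HamiltonianFlow

variable {E : Type*} [NormedAddCommGroup E] [InnerProductSpace ℝ E] [FiniteDimensional ℝ E]

/-- The Hamiltonian vector field of `H(x, p) = w(x) ρ(p)`. -/
noncomputable def hamiltonianField (w ρ : E → ℝ) (a : E × E) : E × E :=
  (w a.1 • gradient ρ a.2, -(ρ a.2 • gradient w a.1))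

theorem contDiff_hamiltonianField {w ρ : E → ℝ} {k : ℕ} (hw : ContDiff ℝ (k + 1 : ℕ) w)
    (hρ : ContDiff ℝ (k + 1 : ℕ) ρ) : ContDiff ℝ k (hamiltonianField w ρ) := by
  have hk : ((k : ℕ) : WithTop ℕ∞) + 1 ≤ (k + 1 : ℕ) := by norm_cast
  have hk' : ((k : ℕ) : WithTop ℕ∞) ≤ (k + 1 : ℕ) := by exact_mod_cast Nat.le_succ k
  exact (((hw.of_le hk').comp contDiff_fst).smul ((contDiff_gradient hρ hk).comp
    contDiff_snd)).prodMk (((hρ.of_le hk').comp contDiff_snd).smul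
      ((contDiff_gradient hw hk).comp contDiff_fst)).neg

theorem hasCompactSupport_hamiltonianField {w ρ : E → ℝ} (hw : HasCompactSupport w)
    (hρ : HasCompactSupport ρ) : HasCompactSupport (hamiltonianField w ρ) := by
  refine HasCompactSupport.intro (hw.isCompact.prod hρ.isCompact) fun a ha => ?_
  rw [mem_prod, not_and_or] at ha
  rcases ha with ha | ha
  · simp [hamiltonianField, image_eq_zero_of_notMem_tsupport ha,
      gradient_eq_zero_of_notMem_tsupport ha]
  · simp [hamiltonianField, image_eq_zero_of_notMem_tsupport ha,
      gradient_eq_zero_of_notMem_tsupport ha]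

/-- What the flow of the Hamiltonian `w(x)|p|` over the graph of `∇Φ` provides for short times:
positions `X` and momenta `P` along the characteristics, and the inverse `g` of the positions. The
function `X'` is the time derivative of `X`; away from the support of `w` nothing moves. -/
structure IsCharacteristicFlow (w Φ : E → ℝ) (τ : ℝ) (X X' P g : ℝ → E → E) : Prop where
  contDiffOn : ContDiffOn ℝ 3 (fun a : ℝ × E => X a.1 a.2) (Ioo (-τ) τ ×ˢ univ)
  contDiffOn' : ContDiffOn ℝ 3 (fun a : ℝ × E => X' a.1 a.2) (Ioo (-τ) τ ×ˢ univ)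
  contDiffOn_inverse : ContDiffOn ℝ 3 (fun a : ℝ × E => g a.1 a.2) (Ioo (-τ) τ ×ˢ univ)
  hasDerivAt : ∀ t ∈ Ioo (-τ) τ, ∀ y, HasDerivAt (fun r => X r y) (X' t y) t
  zero : ∀ y, X 0 y = y
  momentum_zero : ∀ y, P 0 y = gradient Φ y
  inverse_left : ∀ t ∈ Ioo (-τ) τ, ∀ y, g t (X t y) = y
  inverse_right : ∀ t ∈ Ioo (-τ) τ, ∀ x, X t (g t x) = x
  stationary : ∀ t ∈ Ioo (-τ) τ, ∀ y ∉ tsupport w, X t y = y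
  mem_tsupport : ∀ t ∈ Ioo (-τ) τ, ∀ y ∈ tsupport w, X t y ∈ tsupport w
  momentum_ne_zero : ∀ t ∈ Ioo (-τ) τ, ∀ y ∈ tsupport w, P t y ≠ 0
  velocity_eq : ∀ t ∈ Ioo (-τ) τ, ∀ y ∈ tsupport w, X' t y = w (X t y) • (‖P t y‖⁻¹ • P t y)
  momentum_hasDerivAt : ∀ t ∈ Ioo (-τ) τ, ∀ y ∈ tsupport w,
    HasDerivAt (fun r => P r y) (-(‖P t y‖ • gradient w (X t y))) t
  energy : ∀ t ∈ Ioo (-τ) τ, ∀ y ∈ tsupport w, w (X t y) * ‖P t y‖ = w y * ‖gradient Φ y‖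
  momentum_eq : ∀ t ∈ Ioo (-τ) τ, ∀ y ∈ tsupport w,
    gradient (fun x => Φ (g t x)) (X t y) = P t y

/-- A trajectory of a Lipschitz field that meets a zero of the field is constant. -/
theorem eq_of_field_eq_zero {V : Type*} [NormedAddCommGroup V] [NormedSpace ℝ V] {F : V → V}
    {L : ℝ≥0} (hL : LipschitzWith L F) {τ : ℝ} {z : ℝ → V}
    (hz : ∀ t ∈ Ioo (-τ) τ, HasDerivAt z (F (z t)) t) {t₀ : ℝ} (ht₀ : t₀ ∈ Ioo (-τ) τ)
    (h0 : F (z t₀) = 0) : ∀ t ∈ Ioo (-τ) τ, z t = z t₀ := by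
  refine ODE_solution_unique_of_mem_Ioo (v := fun _ => F) (s := fun _ => univ) (K := L)
    (g := fun _ => z t₀) (fun _ _ => hL.lipschitzOnWith) ht₀ (fun t ht => ⟨hz t ht, mem_univ _⟩)
    (fun t _ => ⟨?_, mem_univ _⟩) rfl
  rw [h0]
  exact hasDerivAt_const t _

/-- Where `ρ` is the norm, the momentum component along `p` of the linearized velocity
`w(x)∇ρ(p)` only sees the derivative of `w`, because `∇ρ` is the field of unit vectors `p/|p|` and
its variation is orthogonal to `p`. -/
theorem inner_fderiv_velocity {w ρ : E → ℝ} (hw : ContDiff ℝ 1 w) (hρ : ContDiff ℝ 2 ρ)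
    {X P : E → E} {y : E} (hX : DifferentiableAt ℝ X y) (hP : DifferentiableAt ℝ P y)
    (hρn : ∀ᶠ p in 𝓝 (P y), ρ p = ‖p‖) (hP0 : P y ≠ 0) (e : E) :
    inner ℝ (fderiv ℝ (fun y => w (X y) • gradient ρ (P y)) y e) (P y) =
      ‖P y‖ * inner ℝ (gradient w (X y)) (fderiv ℝ X y e) := by
  have hgrad : ∀ᶠ p in 𝓝 (P y), gradient ρ p = ‖p‖⁻¹ • p := by
    filter_upwards [hρn.eventually_nhds, isOpen_ne.mem_nhds hP0] with p hp hp0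
    exact ((hasGradientAt_norm hp0).congr_of_eventuallyEq hp).gradient
  have hg1 : DifferentiableAt ℝ (gradient ρ) (P y) :=
    (contDiff_gradient hρ (m := 1) (by norm_num)).differentiable one_ne_zero _
  have hw1 : DifferentiableAt ℝ w (X y) := hw.differentiable one_ne_zero _
  have hn0 : ‖P y‖ ≠ 0 := norm_ne_zero_iff.2 hP0
  have horth : ∀ b, inner ℝ (fderiv ℝ (gradient ρ) (P y) b) (P y) = 0 := by
    intro b
    have h1 : HasFDerivAt (fun p => inner ℝ (gradient ρ p) (gradient ρ p))
        (0 : E →L[ℝ] ℝ) (P y) := by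
      refine (hasFDerivAt_const (1 : ℝ) (P y)).congr_of_eventuallyEq ?_
      filter_upwards [hgrad, isOpen_ne.mem_nhds hP0] with p hp hp0
      have : ‖p‖ ≠ 0 := norm_ne_zero_iff.2 hp0
      rw [hp, real_inner_smul_left, real_inner_smul_right, real_inner_self_eq_norm_sq]
      field_simp
    have h2 := congrArg (fun A : E →L[ℝ] ℝ => A b)
      (h1.unique (hg1.hasFDerivAt.inner ℝ hg1.hasFDerivAt))
    simp only [zero_apply, ContinuousLinearMap.comp_apply,
      ContinuousLinearMap.prod_apply, fderivInnerCLM_apply] at h2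
    rw [real_inner_comm, hgrad.self_of_nhds, real_inner_smul_right] at h2
    have h3 : ‖P y‖⁻¹ * inner ℝ (fderiv ℝ (gradient ρ) (P y) b) (P y) = 0 := by linarith
    exact (mul_eq_zero.1 h3).resolve_left (inv_ne_zero hn0)
  have hd := (hw1.hasFDerivAt.comp y hX.hasFDerivAt).smul (hg1.hasFDerivAt.comp y hP.hasFDerivAt)
  have hd' : HasFDerivAt (fun y => w (X y) • gradient ρ (P y)) _ y := hd
  rw [hd'.fderiv]
  simp only [add_apply, smul_apply,
    ContinuousLinearMap.smulRight_apply, ContinuousLinearMap.comp_apply, Function.comp_apply,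
    inner_add_left, real_inner_smul_left, horth, mul_zero, zero_add, hgrad.self_of_nhds,
    real_inner_self_eq_norm_sq, inner_gradient_left]
  field_simp

end HamiltonianFlow

section HamiltonianFlow

variable {E : Type*} [NormedAddCommGroup E] [InnerProductSpace ℝ E] [FiniteDimensional ℝ E]

theorem eq_of_hasDerivAt_zero {f : ℝ → ℝ} {τ : ℝ} (hf : ∀ t ∈ Ioo (-τ) τ, HasDerivAt f 0 t)
    {t : ℝ} (ht : t ∈ Ioo (-τ) τ) : f t = f 0 :=
  isOpen_Ioo.is_const_of_deriv_eq_zero isPreconnected_Ioo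
    (fun s hs => (hf s hs).differentiableAt.differentiableWithinAt) (fun s hs => (hf s hs).deriv)
    ht (by constructor <;> linarith [ht.1, ht.2])

theorem hamiltonianField_eq_zero {w ρ : E → ℝ} {a : E × E} (ha : a.1 ∉ tsupport w) :
    hamiltonianField w ρ a = 0 := by
  simp [hamiltonianField, image_eq_zero_of_notMem_tsupport ha,
    gradient_eq_zero_of_notMem_tsupport ha]

/-- Short-time existence of the characteristic flow. The norm is replaced by a smooth compactly
supported function that equals it near all momenta of the moving characteristics. The momentum is
the gradient of the transported function because `⟨∂ₑX, P⟩` is conserved for every direction `e`. -/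
theorem exists_isCharacteristicFlow {w Φ : E → ℝ} (hw : ContDiff ℝ 4 w)
    (hwc : HasCompactSupport w) (hΦ : ContDiff ℝ 4 Φ)
    (hne : ∀ y ∈ tsupport w, gradient Φ y ≠ 0) :
    ∃ τ > 0, ∃ X X' P g : ℝ → E → E, IsCharacteristicFlow w Φ τ X X' P g := by
  have hgΦ : ContDiff ℝ 3 (gradient Φ) := contDiff_gradient hΦ (by norm_num)
  obtain ⟨c, hc, hcb⟩ := hwc.isCompact.exists_forall_le' (f := fun y => ‖gradient Φ y‖) (a := 0)
    hgΦ.continuous.norm.continuousOn fun y hy => norm_pos_iff.2 (hne y hy)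
  obtain ⟨C, hC⟩ := hwc.isCompact.exists_bound_of_continuousOn hgΦ.continuous.continuousOn
  obtain ⟨ρ, hρ, hρc, hρn⟩ := exists_normCutoff (E := E) (C := C + 1) (half_pos hc)
  have hρ4 : ContDiff ℝ (3 + 1 : ℕ) ρ := contDiff_infty.1 hρ _
  have hρ2 : ContDiff ℝ 2 ρ := contDiff_infty.1 hρ 2
  have hF : ContDiff ℝ (3 : ℕ) (hamiltonianField w ρ) := contDiff_hamiltonianField hw hρ4
  have hFc := hasCompactSupport_hamiltonianField hwc hρc
  obtain ⟨L, hL⟩ := hF.lipschitzWith_of_hasCompactSupport hFc (by norm_num)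
  obtain ⟨M, hM⟩ := hFc.exists_bound_of_continuous hF.continuous
  obtain ⟨τ₀, hτ₀, Z, hZ0, hZd, hZc⟩ := exists_contDiffOn_flow three_ne_zero hF hL
    (M := M.toNNReal) fun x => (hM x).trans (Real.le_coe_toNNReal M)
  set X : ℝ → E → E := fun t y => (Z t (y, gradient Φ y)).1 with hXdef
  set P : ℝ → E → E := fun t y => (Z t (y, gradient Φ y)).2 with hPdef
  set X' : ℝ → E → E := fun t y => w (X t y) • gradient ρ (P t y) with hX'def
  have hZc' : ContDiffOn ℝ 3 (fun a : ℝ × E => Z a.1 (a.2, gradient Φ a.2))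
      (Ioo (-τ₀) τ₀ ×ˢ univ) := by
    refine ContDiffOn.comp (f := fun a : ℝ × E => (a.1, (a.2, gradient Φ a.2))) hZc ?_
      fun a ha => ⟨ha.1, mem_univ _⟩
    exact (contDiff_fst.prodMk (contDiff_snd.prodMk (hgΦ.comp contDiff_snd))).contDiffOn
  have hXc : ContDiffOn ℝ 3 (fun a : ℝ × E => X a.1 a.2) (Ioo (-τ₀) τ₀ ×ˢ univ) :=
    contDiff_fst.comp_contDiffOn hZc'
  have hPc : ContDiffOn ℝ 3 (fun a : ℝ × E => P a.1 a.2) (Ioo (-τ₀) τ₀ ×ˢ univ) :=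
    contDiff_snd.comp_contDiffOn hZc'
  have hX'c : ContDiffOn ℝ 3 (fun a : ℝ × E => X' a.1 a.2) (Ioo (-τ₀) τ₀ ×ˢ univ) :=
    ((hw.of_le (by norm_num)).comp_contDiffOn hXc).smul
      ((contDiff_gradient (m := 3) hρ4 (by norm_num)).comp_contDiffOn hPc)
  have hX0 : ∀ y, X 0 y = y := fun y => by simp only [hXdef, hZ0]
  have hP0 : ∀ y, P 0 y = gradient Φ y := fun y => by simp only [hPdef, hZ0]
  have hXd : ∀ t ∈ Ioo (-τ₀) τ₀, ∀ y, HasDerivAt (fun r => X r y) (X' t y) t := fun t ht y =>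
    (hZd t ht (y, gradient Φ y)).fst
  have hPd : ∀ t ∈ Ioo (-τ₀) τ₀, ∀ y,
      HasDerivAt (fun r => P r y) (-(ρ (P t y) • gradient w (X t y))) t := fun t ht y =>
    (hZd t ht (y, gradient Φ y)).snd
  have h0 : (0 : ℝ) ∈ Ioo (-τ₀) τ₀ := ⟨neg_lt_zero.2 hτ₀, hτ₀⟩
  -- over points off `tsupport w` the Hamiltonian field vanishes, and orbits cannot enter or leave
  have hstat : ∀ t ∈ Ioo (-τ₀) τ₀, ∀ y ∉ tsupport w, X t y = y := by
    intro t ht y hy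
    have := eq_of_field_eq_zero hL (fun s hs => hZd s hs (y, gradient Φ y)) h0
      (hamiltonianField_eq_zero (by rw [hZ0]; exact hy)) t ht
    simp only [hXdef, this, hZ0]
  have hmem : ∀ t ∈ Ioo (-τ₀) τ₀, ∀ y ∈ tsupport w, X t y ∈ tsupport w := by
    intro t ht y hy
    by_contra hcon
    have := eq_of_field_eq_zero hL (fun s hs => hZd s hs (y, gradient Φ y)) ht
      (hamiltonianField_eq_zero hcon) 0 h0
    have h1 : X 0 y = X t y := congrArg Prod.fst this
    rw [hX0] at h1
    exact hcon (h1 ▸ hy)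
  -- for short times, the momenta of the moving characteristics stay where `ρ` is the norm
  have hann : ∀ᶠ t in 𝓝 (0 : ℝ), ∀ y ∈ tsupport w, c / 2 < ‖P t y‖ ∧ ‖P t y‖ < C + 1 := by
    refine hwc.isCompact.eventually_forall_of_forall_eventually fun y hy => ?_
    have h1 : ContinuousAt (fun a : ℝ × E => ‖P a.1 a.2‖) (0, y) :=
      (hPc.continuousOn.continuousAt ((isOpen_Ioo.prod isOpen_univ).mem_nhds
        ⟨h0, mem_univ y⟩)).norm
    refine h1.eventually (isOpen_Ioo.mem_nhds ?_)
    change ‖P 0 y‖ ∈ Ioo (c / 2) (C + 1)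
    rw [hP0]
    exact ⟨by linarith [hcb y hy], by linarith [hC y hy]⟩
  have hsmall : ∀ᶠ t in 𝓝 (0 : ℝ), ∀ y ∈ tsupport w, ‖fderiv ℝ (X t) y - .id ℝ E‖ ≤ 1 / 2 := by
    have h1 := eventually_norm_iteratedFDeriv_sub_le (f := fun t y => fderiv ℝ (X t) y)
      isOpen_Ioo hwc.isCompact h0 0
      (contDiffOn_fderiv_slice (k := 0) isOpen_Ioo (hXc.of_le (by norm_num))) (1 / 2) (by norm_num)
    have hid : X 0 = id := funext hX0
    filter_upwards [h1] with t ht y hy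
    have h2 := ht y hy
    rw [norm_iteratedFDeriv_zero, hid, fderiv_id] at h2
    exact h2
  obtain ⟨τ, hτ, hb⟩ := Metric.eventually_nhds_iff.1
    ((hann.and hsmall).and (isOpen_Ioo.mem_nhds h0))
  have hb' : ∀ t ∈ Ioo (-τ) τ, ((∀ y ∈ tsupport w, c / 2 < ‖P t y‖ ∧ ‖P t y‖ < C + 1) ∧
      ∀ y ∈ tsupport w, ‖fderiv ℝ (X t) y - .id ℝ E‖ ≤ 1 / 2) ∧ t ∈ Ioo (-τ₀) τ₀ := by
    intro t ht
    refine hb ?_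
    rw [Real.dist_eq, sub_zero]
    exact abs_lt.2 ht
  have hsub : Ioo (-τ) τ ⊆ Ioo (-τ₀) τ₀ := fun t ht => (hb' t ht).2
  have hsub' : Ioo (-τ) τ ×ˢ (univ : Set E) ⊆ Ioo (-τ₀) τ₀ ×ˢ univ := prod_mono hsub subset_rfl
  have hsmall' : ∀ t ∈ Ioo (-τ) τ, ∀ y, ‖fderiv ℝ (X t) y - .id ℝ E‖ ≤ 1 / 2 := by
    intro t ht y
    by_cases hy : y ∈ tsupport w
    · exact (hb' t ht).1.2 y hy
    have h1 : X t =ᶠ[𝓝 y] id := by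
      filter_upwards [(isClosed_tsupport w).isOpen_compl.mem_nhds hy] with x hx
      exact hstat t (hsub ht) x hx
    rw [h1.fderiv_eq, fderiv_id, sub_self, norm_zero]
    norm_num
  obtain ⟨g, hgl, hgr, hgc⟩ := exists_contDiffOn_inverse three_ne_zero isOpen_Ioo
    (hXc.mono hsub') hsmall'
  have hPn : ∀ t ∈ Ioo (-τ) τ, ∀ y ∈ tsupport w, P t y ≠ 0 := by
    intro t ht y hy
    have := ((hb' t ht).1.1 y hy).1
    exact norm_pos_iff.1 (by linarith)
  have hρev : ∀ t ∈ Ioo (-τ) τ, ∀ y ∈ tsupport w, ∀ᶠ p in 𝓝 (P t y), ρ p = ‖p‖ := by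
    intro t ht y hy
    have h1 : ∀ᶠ p in 𝓝 (P t y), ‖p‖ ∈ Ioo (c / 2) (C + 1) :=
      continuous_norm.continuousAt.eventually (isOpen_Ioo.mem_nhds ((hb' t ht).1.1 y hy))
    filter_upwards [h1] with p hp using hρn p hp.1 hp.2
  have hρP : ∀ t ∈ Ioo (-τ) τ, ∀ y ∈ tsupport w, ρ (P t y) = ‖P t y‖ := fun t ht y hy =>
    (hρev t ht y hy).self_of_nhds
  have hgρ : ∀ t ∈ Ioo (-τ) τ, ∀ y ∈ tsupport w, gradient ρ (P t y) = ‖P t y‖⁻¹ • P t y :=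
    fun t ht y hy => ((hasGradientAt_norm (hPn t ht y hy)).congr_of_eventuallyEq
      (hρev t ht y hy)).gradient
  have hPd' : ∀ t ∈ Ioo (-τ) τ, ∀ y ∈ tsupport w,
      HasDerivAt (fun r => P r y) (-(‖P t y‖ • gradient w (X t y))) t := by
    intro t ht y hy
    have := hPd t (hsub ht) y
    rwa [hρP t ht y hy] at this
  have hw1 : Differentiable ℝ w := hw.differentiable (by norm_num)
  refine ⟨τ, hτ, X, X', P, g, hXc.mono hsub', hX'c.mono hsub', hgc, fun t ht => hXd t (hsub ht),
    hX0, hP0, hgl, hgr, fun t ht => hstat t (hsub ht), fun t ht => hmem t (hsub ht), hPn,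
    fun t ht y hy => by rw [← hgρ t ht y hy], hPd', ?_, ?_⟩
  · -- the Hamiltonian `w(x) ρ(p)` is a first integral
    intro t ht y hy
    have hder : ∀ s ∈ Ioo (-τ) τ, HasDerivAt (fun s => w (X s y) * ρ (P s y)) 0 s := by
      intro s hs
      have h1 : HasDerivAt (fun s => w (X s y)) (inner ℝ (gradient w (X s y)) (X' s y)) s := by
        rw [inner_gradient_left]
        exact (hw1 (X s y)).hasFDerivAt.comp_hasDerivAt s (hXd s (hsub hs) y)
      have h2 : HasDerivAt (fun s => ρ (P s y))
          (inner ℝ (gradient ρ (P s y)) (-(ρ (P s y) • gradient w (X s y)))) s := by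
        rw [inner_gradient_left]
        exact ((hρ2.differentiable two_ne_zero (P s y)).hasFDerivAt).comp_hasDerivAt s
          (hPd s (hsub hs) y)
      refine (h1.mul h2).congr_deriv ?_
      simp only [hX'def, inner_neg_right, real_inner_smul_right]
      rw [real_inner_comm (gradient ρ (P s y))]
      ring
    have h1 := eq_of_hasDerivAt_zero hder ht
    have h0τ : (0 : ℝ) ∈ Ioo (-τ) τ := ⟨neg_lt_zero.2 hτ, hτ⟩
    simp only [hρP t ht y hy, hρP 0 h0τ y hy] at h1
    rw [h1, hX0, hP0]
  · intro t ht y hy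
    have hXdiff : ∀ s ∈ Ioo (-τ) τ, Differentiable ℝ (X s) := fun s hs =>
      (contDiff_slice hXc (hsub hs)).differentiable three_ne_zero
    have hPdiff : ∀ s ∈ Ioo (-τ) τ, Differentiable ℝ (P s) := fun s hs =>
      (contDiff_slice hPc (hsub hs)).differentiable three_ne_zero
    have hcons : ∀ e, inner ℝ (fderiv ℝ (X t) y e) (P t y) = inner ℝ e (gradient Φ y) := by
      intro e
      have hder : ∀ s ∈ Ioo (-τ) τ,
          HasDerivAt (fun s => inner ℝ (fderiv ℝ (X s) y e) (P s y)) 0 s := by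
        intro s hs
        have h1 := hasDerivAt_fderiv_slice (hXc.of_le (by norm_num)) (hX'c.of_le (by norm_num))
          hXd (hsub hs) y
        have h2 : HasDerivAt (fun s => fderiv ℝ (X s) y e) (fderiv ℝ (X' s) y e) s := by
          simpa using h1.clm_apply (hasDerivAt_const s e)
        refine (h2.inner ℝ (hPd' s hs y hy)).congr_deriv ?_
        rw [inner_fderiv_velocity (hw.of_le (by norm_num)) hρ2 (hXdiff s hs y) (hPdiff s hs y)
          (hρev s hs y hy) (hPn s hs y hy) e, inner_neg_right, real_inner_smul_right,
          real_inner_comm (gradient w (X s y))]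
        ring
      have h1 := eq_of_hasDerivAt_zero hder ht
      have hid : X 0 = id := funext hX0
      simp only [hid, fderiv_id, hP0, ContinuousLinearMap.id_apply] at h1
      exact h1
    have hΦg : DifferentiableAt ℝ (fun x => Φ (g t x)) (X t y) :=
      (hΦ.differentiable (by norm_num) _).comp _
        ((contDiff_slice hgc ht).differentiable three_ne_zero _)
    -- differentiation of `Φ (g t (X t y)) = Φ y` gives the same relation for the gradient
    have hchain : ∀ e, inner ℝ (fderiv ℝ (X t) y e) (gradient (fun x => Φ (g t x)) (X t y)) =
        inner ℝ e (gradient Φ y) := by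
      intro e
      rw [real_inner_comm, inner_gradient_left, real_inner_comm, inner_gradient_left]
      have h1 := hΦg.hasFDerivAt.comp y (hXdiff t ht y).hasFDerivAt
      have h2 : (fun x => Φ (g t x)) ∘ X t = Φ := funext fun y => by simp [hgl t ht y]
      rw [h2] at h1
      rw [h1.fderiv]
      rfl
    -- both vectors agree when paired with the range of `DX`, which is everything
    have hinv := isInvertible_id_sub (t := .id ℝ E - fderiv ℝ (X t) y) (by
      rw [norm_sub_rev]
      exact (hsmall' t ht y).trans_lt (by norm_num))
    rw [sub_sub_cancel] at hinv
    refine ext_inner_left ℝ fun b => ?_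
    rw [← hinv.self_apply_inverse b, hchain, hcons]

end HamiltonianFlow

/-! ### Globally defined data -/

section GlobalData

variable {d : ℕ} {v w Φ₀ : Eucl d → ℝ} {Γ U N : Set (Eucl d)}

/-- A localized velocity extends by zero to a compactly supported `C⁴` function on the whole space,
whose support stays away from the boundary of the cell and from the critical points. -/
theorem IsLocalizedVelocity.exists_extension (hw : IsLocalizedVelocity v Φ₀ Γ U N w)
    (hU : IsOpen U) (hUb : frontier (cell d) ⊆ U) :
    ∃ ω : Eucl d → ℝ, ContDiff ℝ 4 ω ∧ HasCompactSupport ω ∧ tsupport ω ⊆ cell d ∧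
      Disjoint (tsupport ω) U ∧
      (∀ y ∈ tsupport ω, gradientWithin Φ₀ (closure (cell d)) y ≠ 0) ∧
      EqOn ω w (closure (cell d)) := by
  set ω : Eucl d → ℝ := (closure (cell d)).indicator w with hω
  have hωw : EqOn ω w (closure (cell d)) := fun y hy => indicator_of_mem hy w
  have hout : ∀ y ∉ closure (cell d), ω y = 0 := fun y hy => indicator_of_notMem hy w
  have hωU : ∀ y ∈ U, ω y = 0 := by
    intro y hy
    by_cases hyc : y ∈ closure (cell d)
    · rw [hωw hyc, hw.zero_boundary y ⟨hy, hyc⟩]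
    · exact hout y hyc
  obtain ⟨W, hW, hZW, hW0⟩ := hw.zero_critical
  have hωW : ∀ y ∈ W, ω y = 0 := by
    intro y hy
    by_cases hyc : y ∈ closure (cell d)
    · rw [hωw hyc, hW0 y ⟨hy, hyc⟩]
    · exact hout y hyc
  have hts : ∀ {V : Set (Eucl d)}, IsOpen V → (∀ y ∈ V, ω y = 0) → ∀ y ∈ V, y ∉ tsupport ω := by
    intro V hV hV0 y hy
    rw [notMem_tsupport_iff_eventuallyEq]
    filter_upwards [hV.mem_nhds hy] with x hx using hV0 x hx
  have hsub : tsupport ω ⊆ closure (cell d) :=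
    closure_minimal (fun y hy => by
      by_contra h
      exact hy (hout y h)) isClosed_closure
  refine ⟨ω, ?_, isCompact_closure_cell.of_isClosed_subset (isClosed_tsupport ω) hsub,
    fun y hy => mem_cell_of_notMem hUb (hsub hy) fun h => hts hU hωU y h hy,
    disjoint_right.2 (hts hU hωU), fun y hy h => hts hW hωW y (hZW ⟨hsub hy, h⟩) hy, hωw⟩
  rw [contDiff_iff_contDiffAt]
  intro y
  by_cases hyU : y ∈ U
  · refine (contDiffAt_const (c := (0 : ℝ))).congr_of_eventuallyEq ?_
    filter_upwards [hU.mem_nhds hyU] with x hx using hωU x hx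
  by_cases hyc : y ∈ closure (cell d)
  · have hn := closure_cell_nhds (mem_cell_of_notMem hUb hyc hyU)
    refine (hw.regular.1.contDiffAt hn).congr_of_eventuallyEq ?_
    filter_upwards [hn] with x hx using hωw hx
  · refine (contDiffAt_const (c := (0 : ℝ))).congr_of_eventuallyEq ?_
    filter_upwards [isClosed_closure.isOpen_compl.mem_nhds hyc] with x hx using hout x hx

theorem exists_contDiff_eq_nhds {n : ℕ} (hΦ₀ : ContDiffOn ℝ n Φ₀ (closure (cell d)))
    {K : Set (Eucl d)} (hK : IsClosed K) (hKc : K ⊆ cell d) :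
    ∃ Φ : Eucl d → ℝ, ContDiff ℝ n Φ ∧ ∀ᶠ y in 𝓝ˢ K, Φ y = Φ₀ y := by
  obtain ⟨χ, hχ, h1, h0⟩ := exists_contDiff_one_nhds_zero_nhds hK
    isOpen_cell.isClosed_compl (disjoint_compl_right_iff_subset.2 hKc)
  refine ⟨fun y => χ y * Φ₀ y, ?_, ?_⟩
  · rw [contDiff_iff_contDiffAt]
    intro y
    by_cases hy : y ∈ cell d
    · exact (contDiff_infty.1 hχ n).contDiffAt.mul (hΦ₀.contDiffAt (closure_cell_nhds hy))
    · refine (contDiffAt_const (c := (0 : ℝ))).congr_of_eventuallyEq ?_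
      filter_upwards [h0.filter_mono (nhds_le_nhdsSet (show y ∈ (cell d)ᶜ from hy))] with x hx
      rw [hx, zero_mul]
  · filter_upwards [h1] with y hy
    rw [hy, one_mul]

theorem gradientWithin_eq_gradient_of_eqOn {f f' : Eucl d → ℝ} (hf : Differentiable ℝ f')
    (h : EqOn f' f (closure (cell d))) {y : Eucl d} (hy : y ∈ closure (cell d)) :
    gradientWithin f (closure (cell d)) y = gradient f' y := by
  rw [gradientWithin, gradient, ← fderivWithin_congr h (h hy),
    (hf y).fderivWithin (uniqueDiffOn_closure_cell y hy)]

end GlobalData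

/-! ### The transported level-set function -/

namespace IsCharacteristicFlow

section General

variable {E : Type*} [NormedAddCommGroup E] [InnerProductSpace ℝ E] [FiniteDimensional ℝ E]
  {w Φ : E → ℝ} {τ : ℝ} {X X' P g : ℝ → E → E}

theorem inverse_stationary (h : IsCharacteristicFlow w Φ τ X X' P g) {t : ℝ}
    (ht : t ∈ Ioo (-τ) τ) {x : E} (hx : x ∉ tsupport w) : g t x = x := by
  have := h.inverse_left t ht x
  rwa [h.stationary t ht x hx] at this

theorem inverse_mem_tsupport (h : IsCharacteristicFlow w Φ τ X X' P g) {t : ℝ}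
    (ht : t ∈ Ioo (-τ) τ) {x : E} (hx : x ∈ tsupport w) : g t x ∈ tsupport w := by
  by_contra hcon
  have h1 := h.inverse_right t ht x
  rw [h.stationary t ht _ hcon] at h1
  exact hcon (h1.symm ▸ hx)

theorem bijOn (h : IsCharacteristicFlow w Φ τ X X' P g) {t : ℝ} (ht : t ∈ Ioo (-τ) τ) {S : Set E}
    (hS : tsupport w ⊆ S) : BijOn (X t) S S ∧ InvOn (g t) (X t) S S := by
  have h1 : MapsTo (X t) S S := by
    intro y hy
    by_cases hyw : y ∈ tsupport w
    · exact hS (h.mem_tsupport t ht y hyw)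
    · rwa [h.stationary t ht y hyw]
  have h2 : MapsTo (g t) S S := by
    intro y hy
    by_cases hyw : y ∈ tsupport w
    · exact hS (h.inverse_mem_tsupport ht hyw)
    · rwa [h.inverse_stationary ht hyw]
  have h3 : InvOn (g t) (X t) S S :=
    ⟨fun y _ => h.inverse_left t ht y, fun x _ => h.inverse_right t ht x⟩
  exact ⟨h3.bijOn h1 h2, h3⟩

end General

variable {d : ℕ} {w ω Φ₀ Φ₁ : Eucl d → ℝ} {τ T : ℝ} {X X' P g : ℝ → Eucl d → Eucl d}

/-- The transported function is constant along the moving characteristics, so that its time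
derivative is `-⟨P, X'⟩`, which is minus the conserved Hamiltonian. -/
theorem hasDerivAt_transport (h : IsCharacteristicFlow ω Φ₁ τ X X' P g) (hΦ₁ : ContDiff ℝ 4 Φ₁)
    {t : ℝ} (ht : t ∈ Ioo (-τ) τ) {y : Eucl d} (hy : y ∈ tsupport ω) :
    HasDerivAt (fun r => Φ₁ (g r (X t y))) (-(ω y * ‖gradient Φ₁ y‖)) t := by
  have hd : DifferentiableAt ℝ (fun a : ℝ × Eucl d => Φ₁ (g a.1 a.2)) (t, X t y) :=
    (hΦ₁.differentiable (by norm_num) _).comp (t, X t y)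
      ((h.contDiffOn_inverse.contDiffAt ((isOpen_Ioo.prod isOpen_univ).mem_nhds
        ⟨ht, mem_univ _⟩)).differentiableAt three_ne_zero)
  have h1 := hasFDerivAt_of_differentiableAt_prod (Ψ := fun r x => Φ₁ (g r x)) hd
  rw [h.momentum_eq t ht y hy] at h1
  have h2 := HasFDerivAt.comp_hasDerivAt (f := fun r => (r, X r y)) t h1
    ((hasDerivAt_id t).prodMk (h.hasDerivAt t ht y))
  have h3 : HasDerivAt (fun r => Φ₁ (g r (X r y))) 0 t := by
    refine (hasDerivAt_const t (Φ₁ y)).congr_of_eventuallyEq ?_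
    filter_upwards [isOpen_Ioo.mem_nhds ht] with r hr
    rw [h.inverse_left r hr]
  have h4 := h2.unique h3
  have h5 : DifferentiableAt ℝ (fun r => Φ₁ (g r (X t y))) t :=
    DifferentiableAt.comp (f := fun r => (r, X t y)) t hd (by fun_prop)
  have h6 : inner ℝ (P t y) (X' t y) = ω y * ‖gradient Φ₁ y‖ := by
    rw [h.velocity_eq t ht y hy, ← h.energy t ht y hy, real_inner_smul_right,
      real_inner_smul_right, real_inner_self_eq_norm_sq]
    have : ‖P t y‖ ≠ 0 := norm_ne_zero_iff.2 (h.momentum_ne_zero t ht y hy)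
    field_simp
  have h7 : deriv (fun r => Φ₁ (g r (X t y))) t = -(ω y * ‖gradient Φ₁ y‖) := by
    simp [h6] at h4
    linarith
  rw [← h7]
  exact h5.hasDerivAt

end IsCharacteristicFlow

/-- The level-set function at time `t`: the initial function `Φ₀`, corrected near the moving region
by transport of `Φ₁` along the flow with inverse `g`. If `Φ₁ = Φ₀` there, this is `Φ₀ ∘ g t`; the
form used here shows regularity up to the boundary of the cell. -/
def transportedLevelSet {d : ℕ} (Φ₀ Φ₁ : Eucl d → ℝ) (g : ℝ → Eucl d → Eucl d) (t : ℝ)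
    (x : Eucl d) : ℝ :=
  Φ₀ x + (Φ₁ (g t x) - Φ₁ x)

namespace IsCharacteristicFlow

variable {d : ℕ} {w ω Φ₀ Φ₁ : Eucl d → ℝ} {τ T : ℝ} {X X' P g : ℝ → Eucl d → Eucl d}

theorem transportedLevelSet_of_notMem (h : IsCharacteristicFlow ω Φ₁ τ X X' P g) {t : ℝ}
    (ht : t ∈ Ioo (-τ) τ) {x : Eucl d} (hx : x ∉ tsupport ω) :
    transportedLevelSet Φ₀ Φ₁ g t x = Φ₀ x := by
  rw [transportedLevelSet, h.inverse_stationary ht hx, sub_self, add_zero]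

theorem transportedLevelSet_apply (h : IsCharacteristicFlow ω Φ₁ τ X X' P g)
    (hΦ : ∀ᶠ y in 𝓝ˢ (tsupport ω), Φ₁ y = Φ₀ y) {t : ℝ} (ht : t ∈ Ioo (-τ) τ) (y : Eucl d) :
    transportedLevelSet Φ₀ Φ₁ g t (X t y) = Φ₀ y := by
  by_cases hy : y ∈ tsupport ω
  · rw [transportedLevelSet, h.inverse_left t ht, hΦ.self_of_nhdsSet _ (h.mem_tsupport t ht y hy),
      hΦ.self_of_nhdsSet y hy]
    ring
  · rw [h.stationary t ht y hy, h.transportedLevelSet_of_notMem ht hy]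

theorem transportedLevelSet_zero (h : IsCharacteristicFlow ω Φ₁ τ X X' P g) (hτ : 0 < τ)
    (hΦ : ∀ᶠ y in 𝓝ˢ (tsupport ω), Φ₁ y = Φ₀ y) (y : Eucl d) :
    transportedLevelSet Φ₀ Φ₁ g 0 y = Φ₀ y := by
  have := h.transportedLevelSet_apply hΦ ⟨neg_lt_zero.2 hτ, hτ⟩ y
  rwa [h.zero] at this

theorem contDiffOn_transportedLevelSet (h : IsCharacteristicFlow ω Φ₁ τ X X' P g)
    (hΦ₁ : ContDiff ℝ 4 Φ₁) (hΦ₀ : ContDiffOn ℝ 4 Φ₀ (closure (cell d))) :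
    ContDiffOn ℝ 2 (fun q : ℝ × Eucl d => transportedLevelSet Φ₀ Φ₁ g q.1 q.2)
      (Ioo (-τ) τ ×ˢ closure (cell d)) := by
  have h1 : ContDiffOn ℝ 2 (fun q : ℝ × Eucl d => Φ₀ q.2) (Ioo (-τ) τ ×ˢ closure (cell d)) :=
    (hΦ₀.of_le (by norm_num)).comp contDiffOn_snd fun q hq => hq.2
  have h2 : ContDiffOn ℝ 2 (fun q : ℝ × Eucl d => Φ₁ (g q.1 q.2))
      (Ioo (-τ) τ ×ˢ closure (cell d)) :=
    ((hΦ₁.of_le (by norm_num)).comp_contDiffOn (h.contDiffOn_inverse.of_le (by norm_num))).mono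
      (prod_mono subset_rfl (subset_univ _))
  have h3 : ContDiff ℝ 2 (fun q : ℝ × Eucl d => Φ₁ q.2) :=
    (hΦ₁.of_le (by norm_num)).comp contDiff_snd
  exact h1.add (h2.sub h3.contDiffOn)

open Classical in
/-- The momentum along the characteristic over `y`; it is constant if nothing moves near `y`. -/
noncomputable def momentum (_h : IsCharacteristicFlow ω Φ₁ τ X X' P g) (Φ₀ : Eucl d → ℝ) (t : ℝ)
    (y : Eucl d) : Eucl d :=
  if y ∈ tsupport ω then P t y else gradientWithin Φ₀ (closure (cell d)) y

theorem gradient_eq_gradientWithin (hω : tsupport ω ⊆ cell d)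
    (hΦ : ∀ᶠ y in 𝓝ˢ (tsupport ω), Φ₁ y = Φ₀ y) {y : Eucl d} (hy : y ∈ tsupport ω) :
    gradient Φ₁ y = gradientWithin Φ₀ (closure (cell d)) y := by
  rw [gradientWithin_closure_cell (hω hy)]
  exact Filter.EventuallyEq.gradient_eq (hΦ.filter_mono (nhds_le_nhdsSet hy))

theorem hasDerivAt_transportedLevelSet (h : IsCharacteristicFlow ω Φ₁ τ X X' P g)
    (hΦ₁ : ContDiff ℝ 4 Φ₁) (hω : tsupport ω ⊆ cell d) (hωw : EqOn ω w (closure (cell d)))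
    (hΦ : ∀ᶠ y in 𝓝ˢ (tsupport ω), Φ₁ y = Φ₀ y) {t : ℝ} (ht : t ∈ Ioo (-τ) τ) {y : Eucl d}
    (hy : y ∈ closure (cell d)) :
    HasDerivAt (fun r => transportedLevelSet Φ₀ Φ₁ g r (X t y))
      (-(w y * ‖gradientWithin Φ₀ (closure (cell d)) y‖)) t := by
  rw [← hωw hy]
  by_cases hyω : y ∈ tsupport ω
  · rw [← gradient_eq_gradientWithin hω hΦ hyω]
    exact ((h.hasDerivAt_transport hΦ₁ ht hyω).sub_const _).const_add _
  · rw [image_eq_zero_of_notMem_tsupport hyω, zero_mul, neg_zero, h.stationary t ht y hyω]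
    refine (hasDerivAt_const t (Φ₀ y)).congr_of_eventuallyEq ?_
    filter_upwards [isOpen_Ioo.mem_nhds ht] with r hr
    exact h.transportedLevelSet_of_notMem hr hyω

theorem gradientWithin_transportedLevelSet (h : IsCharacteristicFlow ω Φ₁ τ X X' P g)
    (hω : tsupport ω ⊆ cell d) (hΦ : ∀ᶠ y in 𝓝ˢ (tsupport ω), Φ₁ y = Φ₀ y) {t : ℝ}
    (ht : t ∈ Ioo (-τ) τ) (y : Eucl d) :
    gradientWithin (transportedLevelSet Φ₀ Φ₁ g t) (closure (cell d)) (X t y) =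
      h.momentum Φ₀ t y := by
  by_cases hyω : y ∈ tsupport ω
  · rw [momentum, if_pos hyω, ← h.momentum_eq t ht y hyω]
    have hXy := h.mem_tsupport t ht y hyω
    rw [gradientWithin_closure_cell (hω hXy)]
    refine Filter.EventuallyEq.gradient_eq ?_
    filter_upwards [hΦ.filter_mono (nhds_le_nhdsSet hXy)] with x hx
    rw [transportedLevelSet, hx]
    ring
  · rw [momentum, if_neg hyω, h.stationary t ht y hyω, gradientWithin, gradientWithin]
    congr 1
    refine Filter.EventuallyEq.fderivWithin_eq (nhdsWithin_le_nhds ?_)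
      (h.transportedLevelSet_of_notMem ht hyω)
    filter_upwards [(isClosed_tsupport ω).isOpen_compl.mem_nhds hyω] with x hx
    exact h.transportedLevelSet_of_notMem ht hx

/-- Conservation of the Hamiltonian along the characteristics. -/
theorem energy_momentum (h : IsCharacteristicFlow ω Φ₁ τ X X' P g) (hω : tsupport ω ⊆ cell d)
    (hωw : EqOn ω w (closure (cell d))) (hΦ : ∀ᶠ y in 𝓝ˢ (tsupport ω), Φ₁ y = Φ₀ y) {t : ℝ}
    (ht : t ∈ Ioo (-τ) τ) {y : Eucl d} (hy : y ∈ closure (cell d)) :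
    w (X t y) * ‖h.momentum Φ₀ t y‖ = w y * ‖gradientWithin Φ₀ (closure (cell d)) y‖ := by
  by_cases hyω : y ∈ tsupport ω
  · rw [momentum, if_pos hyω, ← hωw hy, ← gradient_eq_gradientWithin hω hΦ hyω,
      ← h.energy t ht y hyω, hωw (subset_closure (hω (h.mem_tsupport t ht y hyω)))]
  · rw [momentum, if_neg hyω, h.stationary t ht y hyω]

theorem isLevelSetSolution (h : IsCharacteristicFlow ω Φ₁ τ X X' P g) (hΦ₁ : ContDiff ℝ 4 Φ₁)
    (hΦ₀ : ContDiffOn ℝ 4 Φ₀ (closure (cell d))) (hω : tsupport ω ⊆ cell d)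
    (hωw : EqOn ω w (closure (cell d))) (hΦ : ∀ᶠ y in 𝓝ˢ (tsupport ω), Φ₁ y = Φ₀ y)
    (hT0 : 0 < T) (hT : T < τ) :
    IsLevelSetSolution w Φ₀ T (closure (cell d)) (transportedLevelSet Φ₀ Φ₁ g) := by
  have hsub : Icc 0 T ⊆ Ioo (-τ) τ := fun t ht => ⟨by linarith [ht.1], ht.2.trans_lt hT⟩
  refine ⟨(h.contDiffOn_transportedLevelSet hΦ₁ hΦ₀).mono (prod_mono hsub subset_rfl),
    fun y _ => h.transportedLevelSet_zero (hT0.trans hT) hΦ y, fun t ht x hx => ?_⟩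
  have htτ := hsub (Ioo_subset_Icc_self ht)
  rw [interior_closure_cell] at hx
  have hxc : x ∈ closure (cell d) := subset_closure hx
  have hXg := h.inverse_right t htτ x
  have hgx : g t x ∈ closure (cell d) := by
    obtain ⟨y, hy, hyx⟩ := (h.bijOn htτ (hω.trans subset_closure)).1.surjOn hxc
    rw [← hyx, h.inverse_left t htτ]
    exact hy
  have h1 := h.hasDerivAt_transportedLevelSet hΦ₁ hω hωw hΦ htτ hgx
  have h2 := h.gradientWithin_transportedLevelSet hω hΦ htτ (g t x)
  have h3 := h.energy_momentum hω hωw hΦ htτ hgx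
  rw [hXg] at h1 h2 h3
  rw [gradientWithin_closure_cell hx] at h2
  rw [h1.deriv, h2, h3]
  ring

/-- By conservation of the Hamiltonian `-q`, the right-hand side `w |p| + q` of the equation for `z`
vanishes, and `q` and `z` are constant. -/
theorem isCharacteristic (h : IsCharacteristicFlow ω Φ₁ τ X X' P g) (hω1 : Differentiable ℝ ω)
    (hω : tsupport ω ⊆ cell d) (hωw : EqOn ω w (closure (cell d)))
    (hΦ : ∀ᶠ y in 𝓝ˢ (tsupport ω), Φ₁ y = Φ₀ y) (hT0 : 0 < T) (hT : T < τ) {y : Eucl d}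
    (hy : y ∈ closure (cell d)) :
    IsCharacteristic w Φ₀ T y (fun s => X s y) (fun s => h.momentum Φ₀ s y)
      (fun _ => -(w y * ‖gradientWithin Φ₀ (closure (cell d)) y‖)) (fun _ => Φ₀ y) := by
  have hsub : Icc 0 T ⊆ Ioo (-τ) τ := fun t ht => ⟨by linarith [ht.1], ht.2.trans_lt hT⟩
  have hmem : ∀ s ∈ Icc 0 T, X s y ∈ closure (cell d) := fun s hs =>
    (h.bijOn (hsub hs) (hω.trans subset_closure)).1.mapsTo hy
  have hgw : ∀ s ∈ Icc 0 T, gradientWithin w (closure (cell d)) (X s y) = gradient ω (X s y) :=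
    fun s hs => gradientWithin_eq_gradient_of_eqOn hω1 hωw (hmem s hs)
  refine ⟨hmem, h.zero y, ?_, rfl, rfl, fun s hs => ?_, fun s hs => ?_,
    fun s _ => hasDerivWithinAt_const _ _ _, fun s hs => ?_⟩
  · by_cases hyω : y ∈ tsupport ω
    · rw [momentum, if_pos hyω, h.momentum_zero, gradient_eq_gradientWithin hω hΦ hyω]
    · rw [momentum, if_neg hyω]
  · by_cases hyω : y ∈ tsupport ω
    · have h1 := h.hasDerivAt s (hsub hs) y
      rw [h.velocity_eq s (hsub hs) y hyω, hωw (hmem s hs)] at h1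
      simp only [momentum, if_pos hyω]
      exact h1.hasDerivWithinAt
    · simp only [h.stationary s (hsub hs) y hyω]
      rw [← hωw hy, image_eq_zero_of_notMem_tsupport hyω, zero_smul]
      refine (hasDerivWithinAt_const s _ y).congr (fun r hr => ?_) ?_
      · exact h.stationary r (hsub hr) y hyω
      · exact h.stationary s (hsub hs) y hyω
  · rw [hgw s hs]
    by_cases hyω : y ∈ tsupport ω
    · simp only [momentum, if_pos hyω]
      exact (h.momentum_hasDerivAt s (hsub hs) y hyω).hasDerivWithinAt
    · simp only [momentum, if_neg hyω]
      rw [h.stationary s (hsub hs) y hyω, gradient_eq_zero_of_notMem_tsupport hyω, smul_zero,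
        neg_zero]
      exact hasDerivWithinAt_const _ _ _
  · refine (hasDerivWithinAt_const s _ (Φ₀ y)).congr_deriv ?_
    rw [← h.energy_momentum hω hωw hΦ (hsub hs) hy, real_inner_smul_left,
      real_inner_self_eq_norm_sq]
    by_cases hp : ‖h.momentum Φ₀ s y‖ = 0
    · simp [hp]
    · field_simp
      ring

theorem isDiffBox {U : Set (Eucl d)} (h : IsCharacteristicFlow ω Φ₁ τ X X' P g)
    (hω : tsupport ω ⊆ cell d) (hωU : Disjoint (tsupport ω) U) {t : ℝ} (ht : t ∈ Ioo (-τ) τ) :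
    IsDiffBox 2 1 U (X t) := by
  obtain ⟨h1, h2⟩ := h.bijOn ht (hω.trans subset_closure)
  exact ⟨h1, isHoelderClass_of_contDiff convex_closure_cell uniqueDiffOn_closure_cell
      isCompact_closure_cell (contDiff_slice h.contDiffOn ht),
    ⟨g t, h2, isHoelderClass_of_contDiff convex_closure_cell uniqueDiffOn_closure_cell
      isCompact_closure_cell (contDiff_slice h.contDiffOn_inverse ht)⟩,
    fun y hy => h.stationary t ht y (disjoint_right.1 hωU hy.1)⟩

theorem eventually_mem_of_isCompact (h : IsCharacteristicFlow ω Φ₁ τ X X' P g) (hτ : 0 < τ)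
    {Γ N : Set (Eucl d)} (hΓ : IsCompact Γ) (hN : IsOpen N) (hΓN : Γ ⊆ N) :
    ∀ᶠ t in 𝓝 (0 : ℝ), ∀ y ∈ Γ, X t y ∈ N := by
  refine hΓ.eventually_forall_of_forall_eventually fun y hy => ?_
  have h1 : ContinuousAt (fun a : ℝ × Eucl d => X a.1 a.2) (0, y) :=
    h.contDiffOn.continuousOn.continuousAt ((isOpen_Ioo.prod isOpen_univ).mem_nhds
      ⟨⟨neg_lt_zero.2 hτ, hτ⟩, mem_univ y⟩)
  refine h1.eventually (hN.mem_nhds ?_)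
  change X 0 y ∈ N
  rw [h.zero]
  exact hΓN hy

theorem zeroSet_subset_image (h : IsCharacteristicFlow ω Φ₁ τ X X' P g)
    (hω : tsupport ω ⊆ cell d) (hΦ : ∀ᶠ y in 𝓝ˢ (tsupport ω), Φ₁ y = Φ₀ y) {t : ℝ}
    (ht : t ∈ Ioo (-τ) τ) :
    {y ∈ cell d | transportedLevelSet Φ₀ Φ₁ g t y = 0} ⊆ X t '' {y ∈ cell d | Φ₀ y = 0} := by
  rintro x ⟨hx, hx0⟩
  obtain ⟨y, hy, rfl⟩ := (h.bijOn ht hω).1.surjOn hx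
  rw [h.transportedLevelSet_apply hΦ ht] at hx0
  exact ⟨y, ⟨hy, hx0⟩, rfl⟩

end IsCharacteristicFlow

section Solutions

variable {d : ℕ} {v w Φ₀ : Eucl d → ℝ} {T T' : ℝ} {D D' : Set (Eucl d)} {Ψ : ℝ → Eucl d → ℝ}

theorem IsLevelSetSolution.mono (h : IsLevelSetSolution v Φ₀ T D Ψ) (hT : T' ≤ T) (hD : D' ⊆ D)
    (hvw : EqOn v w (interior D')) : IsLevelSetSolution w Φ₀ T' D' Ψ := by
  refine ⟨h.contDiffOn.mono (prod_mono (Icc_subset_Icc_right hT) hD),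
    fun y hy => h.initial y (hD hy), fun t ht y hy => ?_⟩
  rw [← hvw hy]
  exact h.equation t ⟨ht.1, ht.2.trans_le hT⟩ y (interior_mono hD hy)

/-- Near a compact set, two solutions agree for a short time. -/
theorem IsLevelSetSolution.exists_eq_near_isCompact {Ψ' : ℝ → Eucl d → ℝ} {Γ : Set (Eucl d)}
    (h : IsLevelSetSolution v Φ₀ T D Ψ) (h' : IsLevelSetSolution v Φ₀ T D Ψ') (hT : 0 < T)
    (hD : IsOpen D) (hΓ : IsCompact Γ) (hΓD : Γ ⊆ D) {C : ℝ} (hC : ∀ y ∈ D, |v y| ≤ C) :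
    ∃ τ ∈ Ioo 0 T, ∃ N' : Set (Eucl d), IsOpen N' ∧ Γ ⊆ N' ∧ N' ⊆ D ∧
      ∀ t ∈ Icc 0 τ, ∀ y ∈ N', Ψ t y = Ψ' t y := by
  obtain ⟨δ, hδ, hsub⟩ := hΓ.exists_thickening_subset_open hD hΓD
  set B : ℝ := max C 0 + 1 with hB
  have hB0 : 0 < B := by positivity
  have hCB : ∀ y ∈ D, |v y| ≤ B := fun y hy =>
    (hC y hy).trans ((le_max_left C 0).trans (by linarith))
  refine ⟨min (T / 2) (δ / 2 / B), ⟨by positivity, (min_le_left _ _).trans_lt (half_lt_self hT)⟩,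
    Metric.thickening (δ / 2) Γ, Metric.isOpen_thickening,
    Metric.self_subset_thickening (half_pos hδ) Γ,
    (Metric.thickening_mono (half_le_self hδ.le) Γ).trans hsub, fun t ht y hy => ?_⟩
  have hball : Metric.closedBall y (δ / 2) ⊆ D := by
    intro x hx
    refine hsub ?_
    rw [Metric.mem_thickening_iff] at hy ⊢
    obtain ⟨z, hz, hyz⟩ := hy
    exact ⟨z, hz, by linarith [dist_triangle x y z, Metric.mem_closedBall.1 hx]⟩
  have hτ : min (T / 2) (δ / 2 / B) < T := (min_le_left _ _).trans_lt (half_lt_self hT)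
  have hBτ : B * min (T / 2) (δ / 2 / B) ≤ δ / 2 := by
    calc B * min (T / 2) (δ / 2 / B) ≤ B * (δ / 2 / B) := by gcongr; exact min_le_right _ _
      _ = δ / 2 := by field_simp
  exact le_antisymm
    (h.le_of_closedBall_subset h' hD hball hB0.le (fun x hx => hCB x (hball hx)) hτ hBτ t ht)
    (h'.le_of_closedBall_subset h hD hball hB0.le (fun x hx => hCB x (hball hx)) hτ hBτ t ht)

end Solutions

/-! ### Evolution of the interface -/

/-- A localized velocity extends by zero to a function `ω` on the whole space, and the initial
function may be replaced near the support of `ω` by a globally smooth `Φ₁`; for these global data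
the characteristic flow exists for a short time. -/
theorem IsLocalizedVelocity.exists_isCharacteristicFlow {d : ℕ} {v Φ₀ w : Eucl d → ℝ}
    {Γ U N : Set (Eucl d)} (hw : IsLocalizedVelocity v Φ₀ Γ U N w)
    (hΦ₀ : ContDiffOn ℝ 4 Φ₀ (closure (cell d))) (hU : IsOpen U) (hUb : frontier (cell d) ⊆ U) :
    ∃ ω Φ₁ : Eucl d → ℝ, ContDiff ℝ 4 ω ∧ tsupport ω ⊆ cell d ∧ Disjoint (tsupport ω) U ∧
      EqOn ω w (closure (cell d)) ∧ ContDiff ℝ 4 Φ₁ ∧ (∀ᶠ y in 𝓝ˢ (tsupport ω), Φ₁ y = Φ₀ y) ∧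
      ∃ τ > 0, ∃ X X' P g, IsCharacteristicFlow ω Φ₁ τ X X' P g := by
  obtain ⟨ω, hω4, hωc, hω, hωU, hne, hωw⟩ := hw.exists_extension hU hUb
  obtain ⟨Φ₁, hΦ₁, hΦ⟩ := exists_contDiff_eq_nhds (n := 4) hΦ₀ (isClosed_tsupport ω) hω
  refine ⟨ω, Φ₁, hω4, hω, hωU, hωw, hΦ₁, hΦ,
    _root_.exists_isCharacteristicFlow hω4 hωc hΦ₁ fun y hy => ?_⟩
  rw [IsCharacteristicFlow.gradient_eq_gradientWithin hω hΦ hy]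
  exact hne y hy

theorem mainTheorem7 {d : ℕ} (hd : 2 ≤ d)
    (v Φ₀ : Eucl d → ℝ) (P Γ U : Set (Eucl d))
    (hv : IsHoelderClass 4 1 (closure (cell d)) v)
    (hΦ₀ : ContDiffOn ℝ 4 Φ₀ (closure (cell d)))
    (hreg : IsRegularLevelSetFunction 4 0 Γ Φ₀)
    (hPY : P ⊆ cell d) (hPc : IsCompact (cell d \ P))
    (hP : closure P = {y ∈ closure (cell d) | Φ₀ y ≤ 0})
    -- the fixed neighbourhood of the exterior boundary, away from the interface
    (hU : IsOpen U) (hUb : frontier (cell d) ⊆ U) (hUΓ : Disjoint (closure U) Γ) :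
    (∃ (N : Set (Eucl d)) (w : Eucl d → ℝ), IsLocalizedVelocity v Φ₀ Γ U N w) ∧
    ∀ (N : Set (Eucl d)) (w : Eucl d → ℝ), IsLocalizedVelocity v Φ₀ Γ U N w →
      ∃ T > 0, ∃ Φ : ℝ → Eucl d → ℝ,
        -- the local-in-time solution exists and is unique
        IsLevelSetSolution w Φ₀ T (closure (cell d)) Φ ∧
        (∀ T' ∈ Ioc 0 T, ∀ Ψ : ℝ → Eucl d → ℝ,
          IsLevelSetSolution w Φ₀ T' (closure (cell d)) Ψ →
          ∀ t ∈ Icc 0 T', ∀ y ∈ closure (cell d), Ψ t y = Φ t y) ∧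
        -- at the interface it is the solution for the given velocity `v`
        IsLevelSetSolution v Φ₀ T N Φ ∧
        (∀ t ∈ Icc 0 T, {y ∈ cell d | Φ t y = 0} ⊆ N) ∧
        (∀ T' ∈ Ioc 0 T, ∀ Ψ : ℝ → Eucl d → ℝ, IsLevelSetSolution v Φ₀ T' N Ψ →
          ∃ T'' ∈ Ioc 0 T', ∃ N' : Set (Eucl d), IsOpen N' ∧ Γ ⊆ N' ∧ N' ⊆ N ∧
            ∀ t ∈ Icc 0 T'', {y ∈ cell d | Φ t y = 0} ⊆ N' ∧ ∀ y ∈ N', Ψ t y = Φ t y) ∧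
        -- its projected characteristics form the path of diffeomorphisms
        ∃ h : ℝ → Eucl d → Eucl d,
          (∀ y ∈ closure (cell d), ∃ (p : ℝ → Eucl d) (q z : ℝ → ℝ),
            IsCharacteristic w Φ₀ T y (fun s => h s y) p q z ∧
            ∀ t ∈ Icc 0 T,
              Φ t (h t y) = z t ∧
              gradientWithin (Φ t) (closure (cell d)) (h t y) = p t ∧
              derivWithin (fun r => Φ r (h t y)) (Icc 0 T) t = q t) ∧
          IsC1Path 2 1 (closure (cell d)) T h ∧
          (∀ t ∈ Icc 0 T, IsDiffBox 2 1 U (h t)) ∧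
          (∀ y ∈ closure (cell d), h 0 y = y) ∧
          ∀ t ∈ Icc 0 T, h t '' closure P = {y ∈ closure (cell d) | Φ t y ≤ 0} := by

  have hΓ : IsCompact Γ := hreg.isCompact
  refine ⟨exists_isLocalizedVelocity hv hΦ₀ hreg hUΓ, fun N w hw => ?_⟩
  obtain ⟨ω, Φ₁, hω4, hω, hωU, hωw, hΦ₁, hΦ, τ, hτ, X, X', p, g, h⟩ :=
    hw.exists_isCharacteristicFlow hΦ₀ hU hUb
  -- the zero set of the solution stays in a given neighbourhood of the interface for a short time
  have hstay : ∀ N' : Set (Eucl d), IsOpen N' → Γ ⊆ N' → ∃ ε ∈ Ioo 0 τ, ∀ t ∈ Icc 0 ε,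
      {y ∈ cell d | transportedLevelSet Φ₀ Φ₁ g t y = 0} ⊆ N' := by
    intro N' hN' hΓN'
    obtain ⟨ε, hε, hball⟩ := Metric.eventually_nhds_iff.1
      (h.eventually_mem_of_isCompact hτ hΓ hN' hΓN')
    refine ⟨min τ ε / 2, ⟨by positivity, ?_⟩, fun t ht x hx => ?_⟩
    · exact (half_lt_self (by positivity)).trans_le (min_le_left _ _)
    · have htm : t < min τ ε := ht.2.trans_lt (half_lt_self (by positivity))
      obtain ⟨y, hy, rfl⟩ := h.zeroSet_subset_image hω hΦ
        ⟨by linarith [ht.1], htm.trans_le (min_le_left _ _)⟩ hx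
      rw [← hreg.eq_zeroSet] at hy
      refine hball ?_ y hy
      rw [Real.dist_eq, sub_zero, abs_of_nonneg ht.1]
      exact htm.trans_le (min_le_right _ _)
  obtain ⟨T, ⟨hT0, hT⟩, hTN⟩ := hstay N hw.isOpen_nhd hw.subset_nhd
  have hsub : Icc 0 T ⊆ Ioo (-τ) τ := fun t ht => ⟨by linarith [ht.1], ht.2.trans_lt hT⟩
  have hsol := h.isLevelSetSolution hΦ₁ hΦ₀ hω hωw hΦ hT0 hT
  have hsolN : IsLevelSetSolution v Φ₀ T N (transportedLevelSet Φ₀ Φ₁ g) :=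
    hsol.mono le_rfl (hw.nhd_subset.trans subset_closure)
      fun y hy => hw.eq_on_nhd y (interior_subset hy)
  refine ⟨T, hT0, transportedLevelSet Φ₀ Φ₁ g, hsol, ?_, hsolN, hTN, ?_, X, ?_, ?_, ?_, ?_, ?_⟩
  · intro T' hT' Ψ hΨ t ht y hy
    have hsol' := hsol.mono hT'.2 subset_rfl (eqOn_refl w _)
    have hwc := hw.regular.1.continuousOn
    exact le_antisymm
      (hΨ.le_of_zero_boundary hU hUb hw.zero_boundary hwc hsol' hΦ₀.continuousOn hT'.1 t ht y hy)
      (hsol'.le_of_zero_boundary hU hUb hw.zero_boundary hwc hΨ hΦ₀.continuousOn hT'.1 t ht y hy)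
  · intro T' hT' Ψ hΨ
    obtain ⟨C, hC⟩ := isCompact_closure_cell.exists_bound_of_continuousOn hv.1.continuousOn
    obtain ⟨σ, hσ, N', hN', hΓN', hN'N, heq⟩ := hΨ.exists_eq_near_isCompact
      (hsolN.mono hT'.2 subset_rfl (eqOn_refl v _)) hT'.1 hw.isOpen_nhd hΓ hw.subset_nhd
      fun y hy => hC y (subset_closure (hw.nhd_subset hy))
    obtain ⟨ε, hε, hεN'⟩ := hstay N' hN' hΓN'
    exact ⟨min σ ε, ⟨lt_min hσ.1 hε.1, (min_le_left _ _).trans hσ.2.le⟩, N', hN', hΓN', hN'N,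
      fun t ht => ⟨hεN' t ⟨ht.1, ht.2.trans (min_le_right _ _)⟩,
        heq t ⟨ht.1, ht.2.trans (min_le_left _ _)⟩⟩⟩
  · intro y hy
    refine ⟨_, _, _, h.isCharacteristic (hω4.differentiable four_ne_zero) hω hωw hΦ hT0 hT hy,
      fun t ht => ⟨h.transportedLevelSet_apply hΦ (hsub ht) y,
        h.gradientWithin_transportedLevelSet hω hΦ (hsub ht) y, ?_⟩⟩
    exact (h.hasDerivAt_transportedLevelSet hΦ₁ hω hωw hΦ (hsub ht) hy).hasDerivWithinAt.derivWithin
      (uniqueDiffOn_Icc hT0 t ht)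
  · exact isC1Path_of_contDiffOn hT convex_closure_cell uniqueDiffOn_closure_cell
      isCompact_closure_cell h.contDiffOn h.contDiffOn' h.hasDerivAt
  · exact fun t ht => h.isDiffBox hω hωU (hsub ht)
  · exact fun y _ => h.zero y
  · intro t ht
    rw [hP]
    have hbij := (h.bijOn (hsub ht) (hω.trans subset_closure)).1
    ext x
    constructor
    · rintro ⟨y, ⟨hy, hy0⟩, rfl⟩
      exact ⟨hbij.mapsTo hy, by rwa [h.transportedLevelSet_apply hΦ (hsub ht)]⟩
    · rintro ⟨hx, hx0⟩
      obtain ⟨y, hy, rfl⟩ := hbij.surjOn hx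
      rw [h.transportedLevelSet_apply hΦ (hsub ht)] at hx0
      exact ⟨y, ⟨hy, hx0⟩, rfl⟩
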